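/- Let $M$ be a smooth finite-dimensional manifold (Hausdorff, $\sigma$-compact, without boundary) and let $E,F\to M$ be smooth vector bundles of finite rank, each with a linear connection. Let $T\in\Gamma(E)$ with zero locus $\Sigma=\{T=0\}$, and let $R:F\to TM$ be a bundle homomorphism, such that at every point of $\Sigma$ the map $\nabla T:TM\to E$ is surjective and $R$ is injective, and every vector field $R(s)$, $s\in\Gamma(F)$, is tangent to $\Sigma$ (i.e. $\nabla_{R(s)}T=0$ on $\Sigma$). Let $\mathfrak I$ be the ideal of the algebra $\mathfrak A(M)$ of multivector fields generated by the functions $T^a$ (i.e. $\langle\lambda,T\rangle$, $\lambda\in\Gamma(E^*)$) and the vector fields $R_\alpha$ (i.e. $R(s)$, $s\in\Gamma(F)$), and assume $[R(s),R(t)]\in\mathfrak I$ for all $s,t\in\Gamma(F)$. With $\llbracket\cdot,\cdot\rrbracket$ the Schouten bracket, a function or vector field $U$ is called projectible if $\llbracket U,\mathfrak I\rrbracket\subseteq\mathfrak I$; projectible functions modulo $\mathfrak I$ are the physical observables, and a projectible vector field $V$ acts on them by $\dot F=\llbracket V,F\rrbracket=V(F)$. Let $\mathcal M=\Pi E\oplus\Pi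 F$ be the supermanifold with base $M$ and odd fibre coordinates $\eta^a$ (ghost number $-1$) and $c^\alpha$ (ghost number $+1$), and let $Q$ be a homological vector field on $\mathcal M$ of ghost number $1$, $Q^2=0$, whose terms of lowest degree in $\eta$ are $T^a\,\partial/\partial\eta^a$ and $c^\alpha R_\alpha^i\,\partial/\partial x^i$: that is, $Q\eta^a|_{\eta=c=0}=T^a$, and $Qf|_{\eta=0}=c^\alpha R_\alpha(f)$ for $f\in C^\infty(M)$. Let $\hat Q=\mathcal L_Q$ be the induced differential on differential forms on $\mathcal M$ (where $d$ has ghost number $-1$). A $1$-form $\omega$ on $M$ is called projectible if it has an extension $\hat\omega$ to a $1$-form on $\mathcal M$ of ghost number $-1$ with $\hat Q\hat\omega=0$. For a projectible vector field $V$, "$\mathcal L_V\omega=0$ in $\hat Q$-cohomology" means that for some such $\hat\omega$ and some extension $\hat V$ of $V$ to a vector field on $\mathcal M$ that preserves the ghost number and satisfies $[Q,\hat V]=0$, one has $\mathcal L_{\hat V}\hat\omega=\hat Q\tau$ for a $1$-form $\tau$ on $\mathcal M$ of ghost number $-2$. Let $V$ and $X$ be projectible vector fields with $\llbracket V,X\rrbracket\in\mathfrak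 I$, and let $\omega$ be a projectible $1$-form with $\mathcal L_V\omega=0$ in $\hat Q$-cohomology. Then $F=\imath_X\omega$ is a physical observable which is an integral of the motion defined by $V$: 1. $F$ is projectible, $\llbracket F,\mathfrak I\rrbracket\subseteq\mathfrak I$; 2. $F$ is invariant under $V$, $\dot F=\llbracket V,F\rrbracket\in\mathfrak I$; 3. if $\hat X$ is an extension of $X$ to a vector field on $\mathcal M$ that preserves the ghost number with $[Q,\hat X]=0$, and $\hat\omega$ is an extension of $\omega$ as above, then $\imath_{\hat X}\hat\omega$ is a $Q$-cocycle that restricts to $F$ on $M$; 4. an integral curve of $V$, defined on an open interval, that meets $\Sigma$ stays in $\Sigma$, and $F$ is constant along it. -/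

import Mathlib

open scoped Manifold ContDiff

noncomputable section

namespace GaugeBRST

/-! ## Algebra over a commutative `ℝ`-algebra `A`

The algebra `A` will be `C^∞(M)`, and the modules `P`, `S` will be the modules of smooth sections of
vector bundles `E`, `F` over `M`. -/

section Multivectors

/-- Vector fields: derivations of the algebra of functions. -/
abbrev VecField (A : Type*) [CommRing A] [Algebra ℝ A] : Type _ := Derivation ℝ A A

/-- Differential `1`-forms: function-linear functionals on vector fields. -/
abbrev OneForm (A : Type*) [CommRing A] [Algebra ℝ A] : Type _ := Module.Dual A (VecField A)

/-- Multivector fields: the exterior algebra of vector fields over functions. -/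
abbrev Multivector (A : Type*) [CommRing A] [Algebra ℝ A] : Type _ := ExteriorAlgebra A (VecField A)

variable {A : Type*} [CommRing A] [Algebra ℝ A]

/-- The exterior derivative of a function. -/
def dFun (f : A) : OneForm A where
  toFun Y := Y f
  map_add' _ _ := rfl
  map_smul' _ _ := rfl

/-- The ring `Λ[ε]`, `ε² = 0`, over the algebra `Λ` of multivector fields, with functions acting
through `f ↦ f + ε V(f)`.  It serves to extend `V` and `[V, ·]` to a derivation of `Λ`. -/
def Twisted (_V : VecField A) : Type _ := DualNumber (Multivector A)

namespace Twisted

variable (V : VecField A)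

instance : Ring (Twisted V) := inferInstanceAs (Ring (DualNumber (Multivector A)))

/-- The element `u + ε w`. -/
def mk (u w : Multivector A) : Twisted V := (u, w)

/-- The component at `1`. -/
def re (x : Twisted V) : Multivector A := TrivSqZeroExt.fst (R := Multivector A) x

/-- The component at `ε`. -/
def ep (x : Twisted V) : Multivector A := TrivSqZeroExt.snd (R := Multivector A) x

variable {V}

theorem ext' {x y : Twisted V} (h : re V x = re V y) (h' : ep V x = ep V y) : x = y :=
  TrivSqZeroExt.ext h h'

@[simp] theorem re_mk (u w : Multivector A) : re V (mk V u w) = u := rfl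
@[simp] theorem ep_mk (u w : Multivector A) : ep V (mk V u w) = w := rfl
@[simp] theorem re_zero : re V 0 = 0 := rfl
@[simp] theorem ep_zero : ep V 0 = 0 := rfl
@[simp] theorem re_one : re V 1 = 1 := rfl
@[simp] theorem ep_one : ep V 1 = 0 := rfl
@[simp] theorem re_add (x y : Twisted V) : re V (x + y) = re V x + re V y := rfl
@[simp] theorem ep_add (x y : Twisted V) : ep V (x + y) = ep V x + ep V y := rfl
@[simp] theorem re_mul (x y : Twisted V) : re V (x * y) = re V x * re V y := rfl
@[simp] theorem ep_mul (x y : Twisted V) : ep V (x * y) = re V x * ep V y + ep V x * re V y := rfl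

variable (V)

/-- The ring map `f ↦ f + ε V(f)`. -/
def scalars : A →+* Twisted V where
  toFun f := mk V (algebraMap A _ f) (algebraMap A _ (V f))
  map_one' := ext' (by simp) (by simp)
  map_zero' := ext' (by simp) (by simp)
  map_add' f g := ext' (by simp) (by simp)
  map_mul' f g := by
    refine ext' (by simp) ?_
    simp only [Derivation.leibniz, smul_eq_mul, map_add, map_mul, ep_mk, ep_mul, re_mk]
    rw [Algebra.commutes (V f) (algebraMap A (Multivector A) g)]

theorem scalars_commutes (f : A) (x : Twisted V) : scalars V f * x = x * scalars V f := by
  refine ext' ?_ ?_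
  · simpa [scalars] using Algebra.commutes f (re V x)
  · simp only [scalars, RingHom.coe_mk, MonoidHom.coe_mk, OneHom.coe_mk, ep_mul, re_mk, ep_mk]
    rw [Algebra.commutes f (ep V x), Algebra.commutes (V f) (re V x), add_comm]

instance : Algebra A (Twisted V) := (scalars V).toAlgebra' (scalars_commutes V)

theorem algebraMap_eq (f : A) : algebraMap A (Twisted V) f = scalars V f := rfl

/-- `Y ↦ Y + ε [V, Y]`. -/
def onVec : VecField A →ₗ[A] Twisted V where
  toFun Y := mk V (ExteriorAlgebra.ι A Y) (ExteriorAlgebra.ι A ⁅V, Y⁆)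
  map_add' Y Z := ext' (by simp) (by simp)
  map_smul' f Y := by
    have h : ⁅V, f • Y⁆ = f • ⁅V, Y⁆ + V f • Y := by
      ext g
      simp [Derivation.commutator_apply]
    refine ext' ?_ ?_
    · simp [Algebra.smul_def, algebraMap_eq, scalars]
    · simp [Algebra.smul_def, algebraMap_eq, scalars, h]

theorem onVec_sq (Y : VecField A) : onVec V Y * onVec V Y = 0 := by
  refine ext' ?_ ?_
  · simp [onVec]
  · simp [onVec]

/-- The ring map `U ↦ U + ε ⟦V, U⟧`. -/
def hom : Multivector A →ₐ[A] Twisted V := ExteriorAlgebra.lift A ⟨onVec V, onVec_sq V⟩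

end Twisted

/-- The Schouten bracket `⟦V, U⟧` of a vector field `V` with a multivector field `U`: the derivation
of the algebra of multivector fields (see `schoutenVec_mul`) which is `V` on functions and the
commutator `[V, ·]` on vector fields. -/
def schoutenVec (V : VecField A) (U : Multivector A) : Multivector A :=
  Twisted.ep V (Twisted.hom V U)

/-- The Schouten bracket `⟦F, U⟧` of a function `F` with a multivector field `U`: minus the
contraction of `U` with `dF`, so that `⟦F, Y⟧ = -Y(F) = -⟦Y, F⟧` for a vector field `Y`. -/
def schoutenFun (F : A) (U : Multivector A) : Multivector A :=
  -CliffordAlgebra.contractLeft (dFun F) U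

theorem schoutenVec_algebraMap (V : VecField A) (f : A) :
    schoutenVec V (algebraMap A _ f) = algebraMap A _ (V f) := by
  unfold schoutenVec
  rw [AlgHom.commutes]
  rfl

theorem schoutenVec_ι (V Y : VecField A) :
    schoutenVec V (ExteriorAlgebra.ι A Y) = ExteriorAlgebra.ι A ⁅V, Y⁆ := by
  unfold schoutenVec Twisted.hom
  rw [ExteriorAlgebra.lift_ι_apply]
  rfl

theorem re_hom (V : VecField A) (U : Multivector A) : Twisted.re V (Twisted.hom V U) = U := by
  induction U using ExteriorAlgebra.induction with
  | algebraMap r => rw [AlgHom.commutes]; rfl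
  | ι x => unfold Twisted.hom; rw [ExteriorAlgebra.lift_ι_apply]; rfl
  | mul a b ha hb => rw [map_mul, Twisted.re_mul, ha, hb]
  | add a b ha hb => rw [map_add, Twisted.re_add, ha, hb]

theorem schoutenVec_add (V : VecField A) (U W : Multivector A) :
    schoutenVec V (U + W) = schoutenVec V U + schoutenVec V W := by
  simp [schoutenVec]

theorem schoutenVec_mul (V : VecField A) (U W : Multivector A) :
    schoutenVec V (U * W) = U * schoutenVec V W + schoutenVec V U * W := by
  simp [schoutenVec, re_hom]

end Multivectors

section Ideal

variable {A : Type*} [CommRing A] [Algebra ℝ A]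
  {P : Type*} [AddCommGroup P] [Module A P] {S : Type*} [AddCommGroup S] [Module A S]

/-- The ideal of trivial multivector fields, generated by the functions `⟨λ, T⟩` (the components
`T^a` of `T`) and the vector fields `R(s)` (combinations of the `R_α`).  The generators being
homogeneous, the left ideal is two-sided. -/
def trivialIdeal (T : P) (R : S →ₗ[A] VecField A) : Ideal (Multivector A) :=
  Ideal.span (Set.range (fun l : Module.Dual A P => algebraMap A (Multivector A) (l T)) ∪
    Set.range (fun s : S => ExteriorAlgebra.ι A (R s)))

/-- A vector field `V` is projectible if `⟦V, 𝔍⟧ ⊆ 𝔍`. -/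
def IsProjectibleVec (T : P) (R : S →ₗ[A] VecField A) (V : VecField A) : Prop :=
  ∀ U ∈ trivialIdeal T R, schoutenVec V U ∈ trivialIdeal T R

/-- A function `F` is projectible if `⟦F, 𝔍⟧ ⊆ 𝔍`. -/
def IsProjectibleFun (T : P) (R : S →ₗ[A] VecField A) (F : A) : Prop :=
  ∀ U ∈ trivialIdeal T R, schoutenFun F U ∈ trivialIdeal T R

end Ideal

/-- A linear connection (covariant derivative) on a module of sections `P`. -/
structure LinearConnection (A : Type*) [CommRing A] [Algebra ℝ A]
    (P : Type*) [AddCommGroup P] [Module A P] where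
  /-- The covariant derivative `∇_Y s`. -/
  nabla : VecField A → P → P
  add_vec : ∀ Y Z s, nabla (Y + Z) s = nabla Y s + nabla Z s
  smul_vec : ∀ (f : A) Y s, nabla (f • Y) s = f • nabla Y s
  add_sec : ∀ Y s t, nabla Y (s + t) = nabla Y s + nabla Y t
  leibniz : ∀ Y (f : A) s, nabla Y (f • s) = f • nabla Y s + Y f • s

/-! ## The extended supermanifold `𝓜 = ΠE ⊕ ΠF` -/

section Super

/-- Functions on the supermanifold `ΠE ⊕ ΠF`: the exterior algebra over `A = C^∞(M)` generated by the
sections of `E* ⊕ F*`, that is, by the odd fibre coordinates `η^a` of `ΠE` and `c^α` of `ΠF`. -/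
abbrev Super (A : Type*) [CommRing A] (P : Type*) [AddCommGroup P] [Module A P]
    (S : Type*) [AddCommGroup S] [Module A S] : Type _ :=
  ExteriorAlgebra A (Module.Dual A P × Module.Dual A S)

variable (A : Type*) [CommRing A] (P : Type*) [AddCommGroup P] [Module A P]
  (S : Type*) [AddCommGroup S] [Module A S]

/-- The fibre-linear functions on `ΠE` (combinations of the `η^a`). -/
def eta : Module.Dual A P →ₗ[A] Super A P S := (ExteriorAlgebra.ι A).comp (LinearMap.inl A _ _)

/-- The fibre-linear functions on `ΠF` (combinations of the ghosts `c^α`). -/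
def ghost : Module.Dual A S →ₗ[A] Super A P S := (ExteriorAlgebra.ι A).comp (LinearMap.inr A _ _)

/-- Functions of ghost number `k`, where `gh x = 0`, `gh η = -1`, `gh c = 1`: the span of the products
of `p` factors `η` and `q` factors `c` with `q - p = k`.  Grassmann parity is `k` modulo `2`. -/
def gh (k : ℤ) : Submodule A (Super A P S) :=
  ⨆ (p : ℕ) (q : ℕ) (_ : (q : ℤ) - p = k),
    LinearMap.range (eta A P S) ^ p * LinearMap.range (ghost A P S) ^ q

/-- Restriction of functions from `𝓜` to `M`, `η = c = 0`. -/
def body : Super A P S →ₐ[A] A := ExteriorAlgebra.algebraMapInv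

/-- Restriction of functions from `𝓜` to `ΠF`, `η = 0`. -/
def restrictF : Super A P S →ₐ[A] ExteriorAlgebra A (Module.Dual A S) :=
  ExteriorAlgebra.map (LinearMap.snd A _ _)

end Super

/-- The sign `(-1)^n`. -/
def sgn (n : ℤ) : ℤ := ((n.negOnePow : ℤˣ) : ℤ)

theorem sgn_add (m n : ℤ) : sgn (m + n) = sgn m * sgn n := by
  simp [sgn, Int.negOnePow_add]

theorem sgn_sq (n : ℤ) : sgn n * sgn n = 1 := by
  rw [← sgn_add]
  simp [sgn, Int.negOnePow_even (n + n) ⟨n, rfl⟩]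

section SuperVectorFields

variable (A : Type*) [CommRing A] [Algebra ℝ A] (P : Type*) [AddCommGroup P] [Module A P]
  (S : Type*) [AddCommGroup S] [Module A S]

/-- Vector fields of ghost number `k` on `𝓜`: graded `ℝ`-linear derivations of degree `k` of the
algebra of functions.  (Together with additivity and the Leibniz rule, the vanishing on real
constants is `ℝ`-linearity.) -/
structure SVec (k : ℤ) where
  /-- The underlying additive map. -/
  act : Super A P S →+ Super A P S
  const' : ∀ r : ℝ, act (algebraMap A (Super A P S) (algebraMap ℝ A r)) = 0
  degree' : ∀ l, ∀ g ∈ gh A P S l, act g ∈ gh A P S (l + k)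
  leibniz' : ∀ l, ∀ g ∈ gh A P S l, ∀ h, act (g * h) = act g * h + sgn (k * l) • (g * act h)

variable {A P S}

instance (k : ℤ) : CoeFun (SVec A P S k) (fun _ => Super A P S → Super A P S) := ⟨fun Y => Y.act⟩

/-- The graded commutator `[Y, Z] = Y Z - (-1)^{jk} Z Y` of vector fields on `𝓜`. -/
def bracket {j k : ℤ} (Y : SVec A P S j) (Z : SVec A P S k) : SVec A P S (j + k) where
  act := Y.act.comp Z.act - sgn (j * k) • Z.act.comp Y.act
  const' r := by simp [Y.const', Z.const']
  degree' l g hg := by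
    have h1 : Y (Z g) ∈ gh A P S (l + (j + k)) := by
      rw [show l + (j + k) = l + k + j by ring]
      exact Y.degree' _ _ (Z.degree' _ _ hg)
    have h2 : Z (Y g) ∈ gh A P S (l + (j + k)) := by
      rw [show l + (j + k) = l + j + k by ring]
      exact Z.degree' _ _ (Y.degree' _ _ hg)
    exact sub_mem h1 (zsmul_mem h2 _)
  leibniz' l g hg h := by
    have e1 : Y (Z (g * h)) = Y (Z g) * h + sgn (j * (l + k)) • (Z g * Y h) +
        sgn (k * l) • (Y g * Z h + sgn (j * l) • (g * Y (Z h))) := by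
      rw [Z.leibniz' l g hg, map_add, map_zsmul, Y.leibniz' _ _ (Z.degree' _ _ hg),
        Y.leibniz' l g hg]
    have e2 : Z (Y (g * h)) = Z (Y g) * h + sgn (k * (l + j)) • (Y g * Z h) +
        sgn (j * l) • (Z g * Y h + sgn (k * l) • (g * Z (Y h))) := by
      rw [Y.leibniz' l g hg, map_add, map_zsmul, Z.leibniz' _ _ (Y.degree' _ _ hg),
        Z.leibniz' l g hg]
    have hs := sgn_sq (j * k)
    simp only [AddMonoidHom.sub_apply, AddMonoidHom.smul_apply, AddMonoidHom.comp_apply]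
    rw [e1, e2]
    simp only [mul_add, add_mul, sgn_add, mul_comm k j, sub_mul, mul_sub, smul_mul_assoc,
      mul_smul_comm, smul_add, smul_sub, smul_smul]
    have a1 : sgn (j * k) * (sgn (k * l) * sgn (j * k)) = sgn (k * l) := by
      rw [mul_left_comm, hs, mul_one]
    rw [a1, show sgn (j * l) * sgn (j * k) = sgn (j * k) * sgn (j * l) by ring,
      show sgn (k * l) * sgn (j * l) = sgn (j * l) * sgn (k * l) by ring,
      show sgn (j * k) * (sgn (j * l) * sgn (k * l)) = sgn (j * l) * sgn (k * l) * sgn (j * k) by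
        ring]
    abel

/-! ## `1`-forms on `𝓜` and Lie derivatives -/

/-- Functions of a homogeneous vector field on `𝓜` with values in functions on `𝓜`. -/
abbrev Cochain (A : Type*) [CommRing A] [Algebra ℝ A] (P : Type*) [AddCommGroup P] [Module A P]
    (S : Type*) [AddCommGroup S] [Module A S] : Type _ :=
  ∀ k : ℤ, SVec A P S k → Super A P S

/-- The `1`-form `dg · f`, as a functional on vector fields: `Y ↦ Y(g) f`. -/
def dMul (g f : Super A P S) : Cochain A P S := fun _ Y => Y g * f

/-- Differential `1`-forms of ghost number `l` on `𝓜`: the finite sums of forms `dg · f` with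
`gh g - 1 + gh f = l` (the differential has ghost number `-1`), regarded as functionals on
vector fields. -/
def SForm (A : Type*) [CommRing A] [Algebra ℝ A] (P : Type*) [AddCommGroup P] [Module A P]
    (S : Type*) [AddCommGroup S] [Module A S] (l : ℤ) : AddSubgroup (Cochain A P S) :=
  AddSubgroup.closure {θ | ∃ i j : ℤ, ∃ g ∈ gh A P S i, ∃ f ∈ gh A P S j,
    i - 1 + j = l ∧ θ = dMul g f}

/-- The Lie derivative of a `1`-form along a vector field `Z` of ghost number `j`:
`⟨Y, L_Z θ⟩ = (-1)^{jk} (Z⟨Y, θ⟩ - ⟨[Z, Y], θ⟩)` for `Y` of ghost number `k`. -/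
def lieD {j : ℤ} (Z : SVec A P S j) : Cochain A P S →+ Cochain A P S where
  toFun θ := fun k Y => sgn (j * k) • (Z (θ k Y) - θ (j + k) (bracket Z Y))
  map_zero' := by funext k Y; simp
  map_add' θ θ' := by
    funext k Y
    simp only [Pi.add_apply, map_add, ← smul_add]
    congr 1
    abel

theorem lieD_dMul {j i : ℤ} (Z : SVec A P S j) {g : Super A P S} (hg : g ∈ gh A P S i)
    (f : Super A P S) : lieD Z (dMul g f) = dMul (Z g) f + sgn (j * i) • dMul g (Z f) := by
  funext k Y
  have hs := sgn_sq (j * k)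
  simp only [lieD, dMul, AddMonoidHom.coe_mk, ZeroHom.coe_mk, Pi.add_apply, Pi.smul_apply, bracket,
    AddMonoidHom.sub_apply, AddMonoidHom.smul_apply, AddMonoidHom.comp_apply]
  rw [Z.leibniz' _ _ (Y.degree' _ _ hg)]
  simp only [mul_add, sgn_add, sub_mul, smul_mul_assoc, smul_add, smul_sub, smul_smul]
  rw [mul_left_comm, hs, mul_one, one_smul]
  abel

/-- The Lie derivative along a vector field of ghost number `j` raises the ghost number of a form
by `j`. -/
theorem lieD_mem {j l : ℤ} (Z : SVec A P S j) {θ : Cochain A P S} (hθ : θ ∈ SForm A P S l) :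
    lieD Z θ ∈ SForm A P S (l + j) := by
  unfold SForm at hθ
  induction hθ using AddSubgroup.closure_induction with
  | mem x hx =>
    obtain ⟨i, m, g, hg, f, hf, rfl, rfl⟩ := hx
    rw [lieD_dMul Z hg]
    refine add_mem ?_ (zsmul_mem ?_ _)
    · exact AddSubgroup.subset_closure
        ⟨i + j, m, Z g, Z.degree' _ _ hg, f, hf, by ring, rfl⟩
    · exact AddSubgroup.subset_closure
        ⟨i, m + j, g, hg, Z f, Z.degree' _ _ hf, by ring, rfl⟩
  | zero => rw [map_zero]; exact zero_mem _
  | add x y _ _ hx hy => rw [map_add]; exact add_mem hx hy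
  | neg x _ hx => rw [map_neg]; exact neg_mem hx

/-! ## The BRST differential -/

/-- The function on `F` linear along the fibres given by `s ↦ R(s)(f)`; in components
`c^α R^i_α ∂_i f`. -/
def longitudinal (R : S →ₗ[A] VecField A) (f : A) : Module.Dual A S := (dFun f).comp R

/-- A BRST differential of `(T, R)`: a homological vector field `Q` of ghost number `1` on `𝓜`, whose
terms of lowest resolution degree are `T^a ∂/∂η^a` and `c^α R^i_α ∂/∂x^i`. -/
structure BRSTDifferential (T : P) (R : S →ₗ[A] VecField A) where
  /-- The homological vector field. -/
  Q : SVec A P S 1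
  homological : ∀ g, Q (Q g) = 0
  on_eta : ∀ l : Module.Dual A P, body A P S (Q (eta A P S l)) = l T
  on_fun : ∀ f : A, restrictF A P S (Q (algebraMap A (Super A P S) f)) =
    ExteriorAlgebra.ι A (longitudinal R f)

/-- The vector field `V'` of ghost number `0` on `𝓜` extends the vector field `V` on `M`. -/
def ExtendsVec (V' : SVec A P S 0) (V : VecField A) : Prop :=
  ∀ f : A, body A P S (V' (algebraMap A (Super A P S) f)) = V f

/-- The `1`-form `θ` on `𝓜` extends the `1`-form `α` on `M`, that is, `α` is the pull-back of `θ`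
along the inclusion of `M` into `𝓜`. -/
def ExtendsForm (θ : Cochain A P S) (α : OneForm A) : Prop :=
  ∀ (Y' : SVec A P S 0) (Y : VecField A), ExtendsVec Y' Y → body A P S (θ 0 Y') = α Y

namespace BRSTDifferential

variable {T : P} {R : S →ₗ[A] VecField A} (D : BRSTDifferential T R)

/-- The differential `Q̂` on forms on `𝓜`, the Lie derivative along `Q`. -/
def Qhat : Cochain A P S →+ Cochain A P S := lieD D.Q

/-- `V'` is an extension of the vector field `V` to `𝓜` which is a `Q`-cocycle, `[Q, V'] = 0`. -/
def IsCocycleExtVec (V' : SVec A P S 0) (V : VecField A) : Prop :=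
  ExtendsVec V' V ∧ ∀ g, bracket D.Q V' g = 0

/-- `θ` is an extension of the `1`-form `α` (of ghost number `-1`) to `𝓜` which is a
`Q̂`-cocycle. -/
def IsCocycleExtForm (θ : Cochain A P S) (α : OneForm A) : Prop :=
  θ ∈ SForm A P S (-1) ∧ ExtendsForm θ α ∧ D.Qhat θ = 0

/-- A projectible `1`-form on `M`: one that extends to a `Q̂`-cocycle. -/
def IsProjectibleForm (α : OneForm A) : Prop := ∃ θ, D.IsCocycleExtForm θ α

/-- `L_V α = 0` in `Q̂`-cohomology: for cocycle extensions `V'`, `θ` of `V`, `α`, the form `L_{V'} θ`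
is the `Q̂`-coboundary of a (not necessarily projectible) `1`-form of ghost number `-2`. -/
def LieDerivativeVanishes (V : VecField A) (α : OneForm A) : Prop :=
  ∃ V' θ, D.IsCocycleExtVec V' V ∧ D.IsCocycleExtForm θ α ∧
    ∃ τ ∈ SForm A P S (-2), lieD V' θ = D.Qhat τ

end BRSTDifferential

end SuperVectorFields

/-! ## Gauge systems on a manifold -/

section Manifold

variable {EM : Type*} [NormedAddCommGroup EM] [NormedSpace ℝ EM]
  {M : Type*} [TopologicalSpace M] [ChartedSpace EM M]
  {FE : Type*} [NormedAddCommGroup FE] [NormedSpace ℝ FE]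
  {E : M → Type*} [TopologicalSpace (Bundle.TotalSpace FE E)] [∀ x, TopologicalSpace (E x)]
  [FiberBundle FE E] [∀ x, AddCommGroup (E x)] [∀ x, Module ℝ (E x)] [VectorBundle ℝ FE E]

instance sectionSMul : SMul C^∞⟮𝓘(ℝ, EM), M; ℝ⟯ Cₛ^∞⟮𝓘(ℝ, EM); FE, E⟯ :=
  ⟨fun f s => ⟨fun x => f x • s x, ContMDiff.smul_section f.contMDiff s.contMDiff⟩⟩

theorem section_smul_apply (f : C^∞⟮𝓘(ℝ, EM), M; ℝ⟯) (s : Cₛ^∞⟮𝓘(ℝ, EM); FE, E⟯) (x : M) :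
    (f • s) x = f x • s x := rfl

/-- Smooth sections form a module over smooth functions, pointwise. -/
instance sectionModule : Module C^∞⟮𝓘(ℝ, EM), M; ℝ⟯ Cₛ^∞⟮𝓘(ℝ, EM); FE, E⟯ where
  one_smul s := by ext x; exact one_smul ℝ (s x)
  mul_smul f g s := by ext x; exact mul_smul (f x) (g x) (s x)
  smul_zero f := by ext x; exact smul_zero (f x)
  smul_add f s t := by ext x; exact smul_add (f x) (s x) (t x)
  add_smul f g s := by ext x; exact add_smul (f x) (g x) (s x)
  zero_smul s := by ext x; exact zero_smul ℝ (s x)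

/-- A gauge system on `M` with vector bundles `E`, `F`: linear connections on `E` and `F`, a section
`T` of `E` whose zero locus is the constraint surface `Σ`, and a homomorphism `R : F → TM`, such that
along `Σ` the covariant derivative `∇T : TM → E` is onto, `R` is injective, the vector fields `R(s)`
are tangent to `Σ`, and they close under commutators modulo `T` and `R`. -/
structure GaugeSystem (EM : Type*) [NormedAddCommGroup EM] [NormedSpace ℝ EM]
    (M : Type*) [TopologicalSpace M] [ChartedSpace EM M]
    (FE : Type*) [NormedAddCommGroup FE] [NormedSpace ℝ FE]
    (E : M → Type*) [TopologicalSpace (Bundle.TotalSpace FE E)] [∀ x, TopologicalSpace (E x)]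
    [FiberBundle FE E] [∀ x, AddCommGroup (E x)] [∀ x, Module ℝ (E x)] [VectorBundle ℝ FE E]
    (FF : Type*) [NormedAddCommGroup FF] [NormedSpace ℝ FF]
    (F : M → Type*) [TopologicalSpace (Bundle.TotalSpace FF F)] [∀ x, TopologicalSpace (F x)]
    [FiberBundle FF F] [∀ x, AddCommGroup (F x)] [∀ x, Module ℝ (F x)] [VectorBundle ℝ FF F]
    where
  connE : LinearConnection C^∞⟮𝓘(ℝ, EM), M; ℝ⟯ Cₛ^∞⟮𝓘(ℝ, EM); FE, E⟯
  connF : LinearConnection C^∞⟮𝓘(ℝ, EM), M; ℝ⟯ Cₛ^∞⟮𝓘(ℝ, EM); FF, F⟯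
  T : Cₛ^∞⟮𝓘(ℝ, EM); FE, E⟯
  R : Cₛ^∞⟮𝓘(ℝ, EM); FF, F⟯ →ₗ[C^∞⟮𝓘(ℝ, EM), M; ℝ⟯] VecField C^∞⟮𝓘(ℝ, EM), M; ℝ⟯
  onto : ∀ p, T p = 0 → ∀ e : E p, ∃ Y, connE.nabla Y T p = e
  injective : ∀ p, T p = 0 → ∀ s, (∀ f, R s f p = 0) → s p = 0
  tangent : ∀ p, T p = 0 → ∀ s, connE.nabla (R s) T p = 0
  involutive : ∀ s t, ExteriorAlgebra.ι _ ⁅R s, R t⁆ ∈ trivialIdeal T R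

/-- `γ : ℝ → M` is an integral curve of the vector field `V` on the set `s` of times. -/
def IsIntegralCurve (V : VecField C^∞⟮𝓘(ℝ, EM), M; ℝ⟯) (γ : ℝ → M) (s : Set ℝ) : Prop :=
  ∀ t ∈ s, ∀ f : C^∞⟮𝓘(ℝ, EM), M; ℝ⟯, HasDerivAt (fun u => f (γ u)) (V f (γ t)) t

end Manifold

end GaugeBRST

end

/-! Write 𝔠 for the ideal of functions ⟨λ, T⟩ (`constraintIdeal`). The theorem reduces to two
memberships: R(s)(α X) ∈ 𝔠 for all s, and V(α X) ∈ 𝔠.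

Counting ghost number gives the basic fact `body_Q_mem`: if g has ghost number -1, then Q g
restricted to M lies in 𝔠, since a monomial of g survives Q and the restriction only if it is a
single η, and Qη restricts to ⟨λ, T⟩. It follows (`body_Qhat_mem`) that a Q̂-exact 1-form of ghost
number -1, evaluated on any lift of a vector field preserving 𝔠, restricts into 𝔠. The lift need not
commute with Q, so the horizontal lift given by the connections serves.

Let i_s = s^α ∂/∂c^α be contraction with a section s of F. Then [Q, i_s] extends R(s). For a cocycle
θ extending α, evaluating Q̂θ = 0 on i_s gives α(R(s)) ∈ 𝔠, so α maps every vector field in the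
trivial ideal into 𝔠. By Cartan calculus, L_{[Q, i_s]} θ = Q̂ L_{i_s} θ is exact. The Leibniz rule
R(s)(α X) = (L_{[Q, i_s]} θ)(X') + α([R(s), X]) then puts both terms in 𝔠. The same rule for V, with
L_{V'} θ = Q̂τ given and [V, X] trivial, yields V(α X) ∈ 𝔠.

For curves, V preserves 𝔠, so the components of T along an integral curve locally solve a linear
homogeneous system; uniqueness and connectedness keep the curve in Σ, where the derivative V(α X)
vanishes. -/

noncomputable section

namespace GaugeBRST

/-! ## Derivations of an exterior algebra covering a derivation of the base -/

section Covering

variable {A : Type*} [CommRing A] [Algebra ℝ A] {N : Type*} [AddCommGroup N] [Module A N]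

/-- The ring `Λ[ε]`, `ε² = 0`, over the exterior algebra `Λ` of `N`, with `A` acting through
`f ↦ f + ε Y(f)`. -/
def Covering (_Y : VecField A) (N : Type*) [AddCommGroup N] [Module A N] : Type _ :=
  DualNumber (ExteriorAlgebra A N)

namespace Covering

variable (Y : VecField A)

instance : Ring (Covering Y N) := inferInstanceAs (Ring (DualNumber (ExteriorAlgebra A N)))

/-- The element `u + ε w`. -/
def mk (u w : ExteriorAlgebra A N) : Covering Y N := (u, w)

variable {Y}

/-- The component at `1`. -/
def re (x : Covering Y N) : ExteriorAlgebra A N :=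
  TrivSqZeroExt.fst (R := ExteriorAlgebra A N) x

/-- The component at `ε`. -/
def ep (x : Covering Y N) : ExteriorAlgebra A N :=
  TrivSqZeroExt.snd (R := ExteriorAlgebra A N) x

theorem ext' {x y : Covering Y N} (h : re x = re y) (h' : ep x = ep y) : x = y :=
  TrivSqZeroExt.ext h h'

@[simp] theorem re_mk (u w : ExteriorAlgebra A N) : re (mk Y u w) = u := rfl
@[simp] theorem ep_mk (u w : ExteriorAlgebra A N) : ep (mk Y u w) = w := rfl
@[simp] theorem re_zero : re (0 : Covering Y N) = 0 := rfl
@[simp] theorem ep_zero : ep (0 : Covering Y N) = 0 := rfl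
@[simp] theorem re_one : re (1 : Covering Y N) = 1 := rfl
@[simp] theorem ep_one : ep (1 : Covering Y N) = 0 := rfl
@[simp] theorem re_add (x y : Covering Y N) : re (x + y) = re x + re y := rfl
@[simp] theorem ep_add (x y : Covering Y N) : ep (x + y) = ep x + ep y := rfl
@[simp] theorem re_mul (x y : Covering Y N) : re (x * y) = re x * re y := rfl
@[simp] theorem ep_mul (x y : Covering Y N) : ep (x * y) = re x * ep y + ep x * re y := rfl

variable (Y)

/-- The ring map `f ↦ f + ε Y(f)`. -/
def scalars (N : Type*) [AddCommGroup N] [Module A N] : A →+* Covering Y N where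
  toFun f := mk Y (algebraMap A _ f) (algebraMap A _ (Y f))
  map_one' := ext' (by simp) (by simp)
  map_zero' := ext' (by simp) (by simp)
  map_add' f g := ext' (by simp) (by simp)
  map_mul' f g := by
    refine ext' (by simp) ?_
    simp only [Derivation.leibniz, smul_eq_mul, map_add, map_mul, ep_mk, ep_mul, re_mk]
    rw [Algebra.commutes (Y f) (algebraMap A (ExteriorAlgebra A N) g)]

theorem scalars_commutes (N : Type*) [AddCommGroup N] [Module A N] (f : A) (x : Covering Y N) : scalars Y N f * x = x * scalars Y N f := by
  refine ext' ?_ ?_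
  · simpa [scalars] using Algebra.commutes f (re x)
  · simp only [scalars, RingHom.coe_mk, MonoidHom.coe_mk, OneHom.coe_mk, ep_mul, re_mk, ep_mk]
    rw [Algebra.commutes f (ep x), Algebra.commutes (Y f) (re x), add_comm]

instance : Algebra A (Covering Y N) := (scalars Y N).toAlgebra' (scalars_commutes Y N)

theorem algebraMap_eq (N : Type*) [AddCommGroup N] [Module A N] (f : A) : algebraMap A (Covering Y N) f = scalars Y N f := rfl

variable (δ : N →+ N) (hδ : ∀ (f : A) n, δ (f • n) = f • δ n + Y f • n)

/-- `n ↦ n + ε δ(n)`. -/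
def onGen : N →ₗ[A] Covering Y N where
  toFun n := mk Y (ExteriorAlgebra.ι A n) (ExteriorAlgebra.ι A (δ n))
  map_add' Y Z := ext' (by simp) (by simp)
  map_smul' f n := by
    refine ext' ?_ ?_
    · simp [Algebra.smul_def, algebraMap_eq, scalars]
    -- The Leibniz rule `hδ` is exactly linearity over the twisted action f ↦ f + ε Y(f).
    · simp [Algebra.smul_def, algebraMap_eq, scalars, hδ]

theorem onGen_sq (n : N) : onGen Y δ hδ n * onGen Y δ hδ n = 0 := by
  refine ext' ?_ ?_
  · simp [onGen]
  · simp [onGen]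

/-- The ring map `u ↦ u + ε D(u)`, for `D` the derivation extending `Y` and `δ`. -/
def hom : ExteriorAlgebra A N →ₐ[A] Covering Y N :=
  ExteriorAlgebra.lift A ⟨onGen Y δ hδ, onGen_sq Y δ hδ⟩

theorem hom_ι (n : N) : hom Y δ hδ (ExteriorAlgebra.ι A n) =
    mk Y (ExteriorAlgebra.ι A n) (ExteriorAlgebra.ι A (δ n)) := by
  unfold hom
  rw [ExteriorAlgebra.lift_ι_apply]
  rfl

theorem re_hom (u : ExteriorAlgebra A N) : re (hom Y δ hδ u) = u := by
  induction u using ExteriorAlgebra.induction with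
  | algebraMap r => rw [AlgHom.commutes]; rfl
  | ι x => rw [hom_ι]; rfl
  | mul a b ha hb => rw [map_mul, re_mul, ha, hb]
  | add a b ha hb => rw [map_add, re_add, ha, hb]

end Covering

variable (Y : VecField A) (δ : N →+ N) (hδ : ∀ (f : A) n, δ (f • n) = f • δ n + Y f • n)

/-- The derivation of the exterior algebra of `N` that is `Y` on scalars and `δ` on `N`. -/
def extDerivation : ExteriorAlgebra A N →+ ExteriorAlgebra A N where
  toFun u := Covering.ep (Covering.hom Y δ hδ u)
  map_zero' := by simp
  map_add' := by simp

theorem extDerivation_algebraMap (f : A) :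
    extDerivation Y δ hδ (algebraMap A _ f) = algebraMap A _ (Y f) := by
  change Covering.ep (Covering.hom Y δ hδ _) = _
  rw [AlgHom.commutes]
  rfl

theorem extDerivation_ι (n : N) :
    extDerivation Y δ hδ (ExteriorAlgebra.ι A n) = ExteriorAlgebra.ι A (δ n) := by
  change Covering.ep (Covering.hom Y δ hδ _) = _
  rw [Covering.hom_ι]
  rfl

theorem extDerivation_mul (u w : ExteriorAlgebra A N) : extDerivation Y δ hδ (u * w) =
    extDerivation Y δ hδ u * w + u * extDerivation Y δ hδ w := by
  change Covering.ep (Covering.hom Y δ hδ _) = _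
  rw [map_mul, Covering.ep_mul, Covering.re_hom, Covering.re_hom, add_comm]
  rfl

/-- Applied to the spans of the η and of the c separately, this makes the horizontal lift preserve
both degrees p and q, hence the ghost number. -/
theorem extDerivation_mem_pow {L : Submodule A (ExteriorAlgebra A N)}
    (hL : ∀ x ∈ L, extDerivation Y δ hδ x ∈ L) (n : ℕ) :
    ∀ x ∈ L ^ n, extDerivation Y δ hδ x ∈ L ^ n := by
  induction n with
  | zero =>
    intro x hx
    rw [pow_zero, Submodule.mem_one] at hx ⊢
    obtain ⟨f, rfl⟩ := hx
    exact ⟨Y f, (extDerivation_algebraMap Y δ hδ f).symm⟩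
  | succ n ih =>
    intro x hx
    rw [pow_succ] at hx ⊢
    induction hx using Submodule.mul_induction_on' with
    | mem_mul_mem u hu w hw =>
      rw [extDerivation_mul]
      exact add_mem (Submodule.mul_mem_mul (ih _ hu) hw) (Submodule.mul_mem_mul hu (hL _ hw))
    | add u _ w _ h h' => rw [map_add]; exact add_mem h h'

end Covering

/-! ## Ghost number -/

section GhostNumber

variable {A : Type*} [CommRing A] {P : Type*} [AddCommGroup P] [Module A P]
  {S : Type*} [AddCommGroup S] [Module A S]

theorem sgn_neg (n : ℤ) : sgn (-n) = sgn n := by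
  simp [sgn, Int.negOnePow_neg]

theorem sgn_natCast (n : ℕ) : sgn n = (-1) ^ n := by
  simp [sgn, Int.negOnePow_def]

theorem mul_mem_gh {p q : ℕ} {k : ℤ} (h : (q : ℤ) - p = k) {x y : Super A P S}
    (hx : x ∈ LinearMap.range (eta A P S) ^ p) (hy : y ∈ LinearMap.range (ghost A P S) ^ q) :
    x * y ∈ gh A P S k :=
  Submodule.mem_iSup_of_mem p <| Submodule.mem_iSup_of_mem q <| Submodule.mem_iSup_of_mem h <|
    Submodule.mul_mem_mul hx hy

theorem mem_gh_of_eta_pow {p : ℕ} {x : Super A P S}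
    (hx : x ∈ LinearMap.range (eta A P S) ^ p) : x ∈ gh A P S (-p) := by
  rw [← mul_one x]
  exact mul_mem_gh (q := 0) (by simp) hx (by rw [pow_zero]; exact Submodule.one_le.mp le_rfl)

theorem mem_gh_of_ghost_pow {q : ℕ} {y : Super A P S}
    (hy : y ∈ LinearMap.range (ghost A P S) ^ q) : y ∈ gh A P S q := by
  rw [← one_mul y]
  exact mul_mem_gh (p := 0) (by simp) (by rw [pow_zero]; exact Submodule.one_le.mp le_rfl) hy

theorem algebraMap_mem_gh (f : A) : algebraMap A (Super A P S) f ∈ gh A P S 0 := by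
  simpa using mem_gh_of_eta_pow (P := P) (S := S) (p := 0)
    (by rw [pow_zero]; exact Submodule.algebraMap_mem f)

theorem gh_induction {k : ℤ} {motive : Super A P S → Prop}
    (mul : ∀ (p q : ℕ) (x y : Super A P S), (q : ℤ) - p = k →
      x ∈ LinearMap.range (eta A P S) ^ p → y ∈ LinearMap.range (ghost A P S) ^ q →
      motive (x * y))
    (zero : motive 0) (add : ∀ x y, motive x → motive y → motive (x + y))
    : ∀ g ∈ gh A P S k, motive g := by
  intro g hg
  refine Submodule.iSup_induction _ (motive := motive) hg (fun p x hx => ?_) zero add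
  refine Submodule.iSup_induction _ (motive := motive) hx (fun q x hx => ?_) zero add
  refine Submodule.iSup_induction _ (motive := motive) hx (fun h x hx => ?_) zero add
  exact Submodule.mul_induction_on hx (fun u hu w hw => mul p q u w h hu hw) add

theorem body_ι (n : Module.Dual A P × Module.Dual A S) :
    body A P S (ExteriorAlgebra.ι A n) = 0 := by
  simp [body, ExteriorAlgebra.algebraMapInv]

theorem body_algebraMap (f : A) : body A P S (algebraMap A _ f) = f := by
  rw [AlgHom.commutes]
  rfl

theorem range_eta_le : LinearMap.range (eta A P S) ≤ LinearMap.range (ExteriorAlgebra.ι A) := by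
  rintro _ ⟨l, rfl⟩
  exact ⟨_, rfl⟩

theorem range_ghost_le : LinearMap.range (ghost A P S) ≤ LinearMap.range (ExteriorAlgebra.ι A) := by
  rintro _ ⟨l, rfl⟩
  exact ⟨_, rfl⟩

theorem body_eq_zero_of_mem_pow {n : ℕ} (hn : n ≠ 0) {x : Super A P S}
    (hx : x ∈ LinearMap.range (ExteriorAlgebra.ι A) ^ n) : body A P S x = 0 := by
  obtain ⟨m, rfl⟩ := Nat.exists_eq_succ_of_ne_zero hn
  rw [Nat.succ_eq_add_one, pow_succ] at hx
  refine Submodule.mul_induction_on hx ?_ (fun u w hu hw => by rw [map_add, hu, hw, add_zero])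
  rintro u - _ ⟨n, rfl⟩
  rw [map_mul, body_ι, mul_zero]

theorem body_eq_zero_of_eta_pow {p : ℕ} (hp : p ≠ 0) {x : Super A P S}
    (hx : x ∈ LinearMap.range (eta A P S) ^ p) : body A P S x = 0 :=
  body_eq_zero_of_mem_pow hp (pow_le_pow_left' range_eta_le p hx)

theorem body_eq_zero_of_ghost_pow {q : ℕ} (hq : q ≠ 0) {y : Super A P S}
    (hy : y ∈ LinearMap.range (ghost A P S) ^ q) : body A P S y = 0 :=
  body_eq_zero_of_mem_pow hq (pow_le_pow_left' range_ghost_le q hy)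

/-- Nonzero ghost number forces p ≠ q, so every monomial has an odd factor, which vanishes on M. -/
theorem body_eq_zero_of_mem_gh {k : ℤ} (hk : k ≠ 0) :
    ∀ g ∈ gh A P S k, body A P S g = 0 := by
  refine gh_induction ?_ (map_zero _) (fun u w hu hw => by rw [map_add, hu, hw, add_zero])
  intro p q x y h hx hy
  rw [map_mul]
  by_cases hp : p = 0
  · rw [body_eq_zero_of_ghost_pow (by omega) hy, mul_zero]
  · rw [body_eq_zero_of_eta_pow hp hx, zero_mul]

/-- The restriction to `M` factors through the restriction to `ΠF`. -/
theorem body_eq_of_restrictF (g : Super A P S) :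
    ExteriorAlgebra.algebraMapInv (restrictF A P S g) = body A P S g := by
  have h : (ExteriorAlgebra.algebraMapInv).comp (restrictF A P S) = body A P S := by
    refine ExteriorAlgebra.hom_ext (LinearMap.ext fun n => ?_)
    change ExteriorAlgebra.algebraMapInv (restrictF A P S (ExteriorAlgebra.ι A n)) =
      body A P S (ExteriorAlgebra.ι A n)
    rw [body_ι, restrictF, ExteriorAlgebra.map_apply_ι]
    simp [ExteriorAlgebra.algebraMapInv]
  exact DFunLike.congr_fun h g

end GhostNumber

/-! ## Contraction with sections and covariant lifts -/

section Contraction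

variable {A : Type*} [CommRing A] {N : Type*} [AddCommGroup N] [Module A N]

/-- The contraction of the exterior algebra with a functional. -/
def contract (d : Module.Dual A N) : ExteriorAlgebra A N →ₗ[A] ExteriorAlgebra A N :=
  CliffordAlgebra.contractLeft (Q := (0 : QuadraticForm A N)) d

variable (d : Module.Dual A N)

theorem contractLeft_eq_contract :
    CliffordAlgebra.contractLeft (Q := (0 : QuadraticForm A N)) d = contract d := rfl

theorem contract_ι_mul (n : N) (x : ExteriorAlgebra A N) :
    contract d (ExteriorAlgebra.ι A n * x) = d n • x - ExteriorAlgebra.ι A n * contract d x :=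
  CliffordAlgebra.contractLeft_ι_mul _ _ _

theorem contract_algebraMap (f : A) : contract d (algebraMap A (ExteriorAlgebra A N) f) = 0 :=
  CliffordAlgebra.contractLeft_algebraMap _ _ _

theorem contract_ι (n : N) : contract d (ExteriorAlgebra.ι A n) = algebraMap A _ (d n) :=
  CliffordAlgebra.contractLeft_ι _ _ _

attribute [irreducible] contract

theorem contract_mul_of_mem_pow {n : ℕ} {x : ExteriorAlgebra A N}
    (hx : x ∈ LinearMap.range (ExteriorAlgebra.ι A (M := N)) ^ n) (h : ExteriorAlgebra A N) :
    contract d (x * h) = contract d x * h + (-1 : ℤ) ^ n • (x * contract d h) := by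
  induction n generalizing x h with
  | zero =>
    rw [pow_zero, Submodule.mem_one] at hx
    obtain ⟨f, rfl⟩ := hx
    rw [contract_algebraMap, ← Algebra.smul_def, ← Algebra.smul_def, map_smul]
    simp
  | succ n ih =>
    rw [pow_succ'] at hx
    induction hx using Submodule.mul_induction_on' with
    | mem_mul_mem u hu w hw =>
      obtain ⟨v, rfl⟩ := hu
      rw [mul_assoc, contract_ι_mul, contract_ι_mul, ih hw, sub_mul, mul_add, pow_succ]
      simp only [mul_neg, mul_one, neg_smul, mul_smul_comm, smul_mul_assoc, mul_assoc]
      abel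
    | add u _ w _ hu hw =>
      rw [add_mul, map_add, map_add, hu, hw, add_mul, add_mul, smul_add]
      abel

end Contraction

/-! ### Contraction of functions on 𝓜 with a section of F -/

section GhostContraction

variable {A : Type*} [CommRing A] {P : Type*} [AddCommGroup P] [Module A P]
  {S : Type*} [AddCommGroup S] [Module A S]

/-- The functional on the generators of `Super` that evaluates the ghosts on `s`. -/
def ghostEval (P : Type*) [AddCommGroup P] [Module A P] (s : S) :
    Module.Dual A (Module.Dual A P × Module.Dual A S) :=
  (Module.Dual.eval A S s).comp (LinearMap.snd A _ _)

theorem contract_eta_mul (s : S) (l : Module.Dual A P) (x : Super A P S) :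
    contract (ghostEval P s) (eta A P S l * x) =
      -(eta A P S l * contract (ghostEval P s) x) := by
  refine (contract_ι_mul _ _ _).trans ?_
  simp [ghostEval, eta]

theorem contract_ghost_mul (s : S) (m : Module.Dual A S) (x : Super A P S) :
    contract (ghostEval P s) (ghost A P S m * x) =
      m s • x - ghost A P S m * contract (ghostEval P s) x :=
  contract_ι_mul _ _ _

theorem contract_eta_pow (s : S) (p : ℕ) {x : Super A P S}
    (hx : x ∈ LinearMap.range (eta A P S) ^ p) : contract (ghostEval P s) x = 0 := by
  induction p generalizing x with
  | zero =>
    rw [pow_zero, Submodule.mem_one] at hx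
    obtain ⟨f, rfl⟩ := hx
    exact contract_algebraMap _ _
  | succ p ih =>
    rw [pow_succ'] at hx
    refine Submodule.mul_induction_on hx ?_ (fun u w hu hw => by rw [map_add, hu, hw, add_zero])
    rintro _ ⟨l, rfl⟩ w hw
    rw [contract_eta_mul, ih hw, mul_zero, neg_zero]

theorem contract_ghost_pow (s : S) (q : ℕ) {y : Super A P S}
    (hy : y ∈ LinearMap.range (ghost A P S) ^ (q + 1)) :
    contract (ghostEval P s) y ∈ LinearMap.range (ghost A P S) ^ q := by
  induction q generalizing y with
  | zero =>
    rw [zero_add, pow_one] at hy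
    obtain ⟨m, rfl⟩ := hy
    rw [pow_zero, Submodule.mem_one]
    exact ⟨_, (contract_ι _ _).symm⟩
  | succ q ih =>
    rw [pow_succ'] at hy
    refine Submodule.mul_induction_on hy ?_ (fun u w hu hw => by rw [map_add]; exact add_mem hu hw)
    rintro _ ⟨l, rfl⟩ w hw
    rw [contract_ghost_mul]
    refine sub_mem (Submodule.smul_mem _ _ hw) ?_
    rw [pow_succ']
    exact Submodule.mul_mem_mul ⟨l, rfl⟩ (ih hw)

theorem contract_mem_gh (s : S) {l : ℤ} :
    ∀ g ∈ gh A P S l, contract (ghostEval P s) g ∈ gh A P S (l + -1) := by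
  refine gh_induction ?_ ?_ ?_
  · intro p q x y h hx hy
    rw [contract_mul_of_mem_pow _ (pow_le_pow_left' range_eta_le p hx),
      contract_eta_pow s p hx, zero_mul, zero_add]
    refine zsmul_mem ?_ _
    cases q with
    | zero =>
      rw [pow_zero, Submodule.mem_one] at hy
      obtain ⟨f, rfl⟩ := hy
      rw [contract_algebraMap, mul_zero]
      exact zero_mem _
    | succ q =>
      exact mul_mem_gh (by push_cast at h; omega) hx (contract_ghost_pow s q hy)
  · rw [map_zero]
    exact zero_mem _
  · intro u w hu hw
    rw [map_add]
    exact add_mem hu hw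

theorem contract_mul_of_mem_gh (d : Module.Dual A (Module.Dual A P × Module.Dual A S)) {l : ℤ} :
    ∀ g ∈ gh A P S l, ∀ h : Super A P S, contract d (g * h) =
      contract d g * h + sgn (-1 * l) • (g * contract d h) := by
  refine gh_induction ?_ ?_ ?_
  · intro p q x y e hx hy h
    have hxy : x * y ∈ LinearMap.range (ExteriorAlgebra.ι A) ^ (p + q) := by
      rw [pow_add]
      exact Submodule.mul_mem_mul (pow_le_pow_left' range_eta_le p hx)
        (pow_le_pow_left' range_ghost_le q hy)
    -- The ghost number q - p and the exterior degree p + q have the same parity, so the Leibniz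
    -- sign of the exterior algebra is the one of the ghost grading.
    have hs : sgn (-1 * l) = (-1) ^ (p + q) := by
      rw [← e, neg_one_mul, sgn_neg, ← sgn_natCast, sub_eq_add_neg, sgn_add, sgn_neg,
        Nat.cast_add, sgn_add, mul_comm]
    rw [hs]
    exact contract_mul_of_mem_pow d hxy h
  · intro h
    rw [zero_mul, map_zero, zero_mul, zero_mul, smul_zero, add_zero]
  · intro u w hu hw h
    rw [add_mul, map_add, map_add, hu, hw, add_mul, add_mul, smul_add]
    abel

/-- The contraction with `s` of a function, restricted to `M`, depends only on the restriction of
the function to `ΠF`. -/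
theorem body_contract (s : S) (g : Super A P S) :
    body A P S (contract (ghostEval P s) g) = ExteriorAlgebra.algebraMapInv
      (contract (Module.Dual.eval A S s) (restrictF A P S g)) := by
  induction g using CliffordAlgebra.left_induction with
  | algebraMap f =>
    have h1 : restrictF A P S (algebraMap A (Super A P S) f) = algebraMap A _ f :=
      AlgHom.commutes _ _
    exact (congrArg (body A P S) (contract_algebraMap _ f)).trans <| (map_zero _).trans <|
      (map_zero _).symm.trans <| congrArg _ <| (contract_algebraMap _ f).symm.trans <|
        congrArg _ h1.symm
  | add x y hx hy => simp only [map_add, hx, hy]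
  | ι_mul x n ih =>
    have h2 : restrictF A P S (ExteriorAlgebra.ι A n * x) =
        ExteriorAlgebra.ι A n.2 * restrictF A P S x := by
      rw [map_mul, restrictF, ExteriorAlgebra.map_apply_ι]
      rfl
    have h4 : ExteriorAlgebra.algebraMapInv (ExteriorAlgebra.ι A n.2) = (0 : A) := by
      simp [ExteriorAlgebra.algebraMapInv]
    change body A P S (contract (ghostEval P s) (ExteriorAlgebra.ι A n * x)) =
      ExteriorAlgebra.algebraMapInv (contract (Module.Dual.eval A S s)
        (restrictF A P S (ExteriorAlgebra.ι A n * x)))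
    rw [h2, contract_ι_mul, contract_ι_mul, map_sub, map_mul, body_ι, map_sub, map_mul, h4,
      map_smul, map_smul, body_eq_of_restrictF]
    simp [ghostEval]

end GhostContraction

/-! ### Vector fields on 𝓜 induced by sections of F and by vector fields on M -/

section Lifts

variable {A : Type*} [CommRing A] [Algebra ℝ A] {P : Type*} [AddCommGroup P] [Module A P]
  {S : Type*} [AddCommGroup S] [Module A S]

/-- The contraction with a section `s` of `F`, the vector field `s^α ∂/∂c^α` on `𝓜`. -/
def ghostContract (P : Type*) [AddCommGroup P] [Module A P] (s : S) : SVec A P S (-1) where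
  act := (contract (ghostEval P s)).toAddMonoidHom
  const' r := by rw [LinearMap.toAddMonoidHom_coe, contract_algebraMap]
  degree' l g hg := by exact contract_mem_gh s g hg
  leibniz' l g hg h := by exact contract_mul_of_mem_gh (ghostEval P s) g hg h

theorem ghostContract_apply (s : S) (g : Super A P S) :
    ghostContract P s g = contract (ghostEval P s) g := rfl

/-- The dual of a linear connection. -/
def LinearConnection.dual (c : LinearConnection A P) (Y : VecField A) :
    Module.Dual A P →+ Module.Dual A P where
  toFun l :=
    { toFun s := Y (l s) - l (c.nabla Y s)
      map_add' s t := by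
        rw [c.add_sec, map_add, map_add, map_add]
        abel
      map_smul' f s := by
        rw [c.leibniz, map_add l, map_smul l, map_smul l, map_smul l, smul_eq_mul,
          Derivation.leibniz]
        simp only [smul_eq_mul, RingHom.id_apply]
        ring }
  map_zero' := by ext; simp
  map_add' l m := by
    ext s
    simp only [LinearMap.coe_mk, AddHom.coe_mk, LinearMap.add_apply, map_add]
    abel

theorem LinearConnection.dual_smul (c : LinearConnection A P) (Y : VecField A) (f : A)
    (l : Module.Dual A P) : c.dual Y (f • l) = f • c.dual Y l + Y f • l := by
  ext s
  simp only [dual, AddMonoidHom.coe_mk, ZeroHom.coe_mk, LinearMap.coe_mk, AddHom.coe_mk,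
    LinearMap.add_apply, LinearMap.smul_apply, smul_eq_mul, Derivation.leibniz]
  ring

/-- The vector field on `𝓜` of ghost number `0` that lifts the vector field `Y` on `M`
horizontally, by means of connections on `E` and `F`. -/
def horizontalLift (c : LinearConnection A P) (c' : LinearConnection A S) (Y : VecField A) :
    SVec A P S 0 where
  act := extDerivation Y ((c.dual Y).prodMap (c'.dual Y)) fun f n =>
    Prod.ext (c.dual_smul Y f n.1) (c'.dual_smul Y f n.2)
  const' r := by rw [extDerivation_algebraMap, Derivation.map_algebraMap, map_zero]
  degree' l := by
    rw [add_zero]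
    refine gh_induction ?_ (by rw [map_zero]; exact zero_mem _)
      (fun u w hu hw => by rw [map_add]; exact add_mem hu hw)
    intro p q x y h hx hy
    rw [extDerivation_mul]
    refine add_mem (mul_mem_gh h (extDerivation_mem_pow _ _ _ ?_ p x hx) hy)
      (mul_mem_gh h hx (extDerivation_mem_pow _ _ _ ?_ q y hy))
    · rintro _ ⟨l, rfl⟩
      refine ⟨c.dual Y l, ?_⟩
      refine Eq.trans ?_ (extDerivation_ι _ _ _ _).symm
      exact congrArg (ExteriorAlgebra.ι A) (show (c.dual Y l, 0) = (c.dual Y l, c'.dual Y 0) by rw [map_zero])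
    · rintro _ ⟨l, rfl⟩
      refine ⟨c'.dual Y l, ?_⟩
      refine Eq.trans ?_ (extDerivation_ι _ _ _ _).symm
      exact congrArg (ExteriorAlgebra.ι A) (show (0, c'.dual Y l) = (c.dual Y 0, c'.dual Y l) by rw [map_zero])
  leibniz' l g hg h := by
    rw [extDerivation_mul, zero_mul]
    simp [sgn]

theorem horizontalLift_extends (c : LinearConnection A P) (c' : LinearConnection A S)
    (Y : VecField A) : ExtendsVec (horizontalLift c c' Y) Y := by
  intro f
  change body A P S (extDerivation _ _ _ _) = _
  rw [extDerivation_algebraMap, body_algebraMap]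

end Lifts

/-! ## The ideal of functions vanishing on the constraint surface -/

section ConstraintIdeal

variable {A : Type*} [CommRing A] [Algebra ℝ A] {P : Type*} [AddCommGroup P] [Module A P]
  {S : Type*} [AddCommGroup S] [Module A S]

/-- The ideal of functions formed by the `⟨λ, T⟩`. -/
def constraintIdeal (T : P) : Ideal A := LinearMap.range (Module.Dual.eval A P T)

variable {T : P} {R : S →ₗ[A] VecField A}

/-- The augmentation of the exterior algebra kills the generators R(s) and sends the others into 𝔠,
so the trivial ideal contains no further functions. -/
theorem algebraMap_mem_trivialIdeal {f : A} :
    algebraMap A (Multivector A) f ∈ trivialIdeal T R ↔ f ∈ constraintIdeal T := by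
  constructor
  · intro h
    have hle : trivialIdeal T R ≤
        Ideal.comap (ExteriorAlgebra.algebraMapInv (R := A) (M := VecField A))
          (constraintIdeal T) := by
      refine Ideal.span_le.mpr ?_
      rintro _ (⟨l, rfl⟩ | ⟨s, rfl⟩)
      · simp only [SetLike.mem_coe, Ideal.mem_comap, AlgHom.commutes]
        exact ⟨l, rfl⟩
      · simp [ExteriorAlgebra.algebraMapInv]
    have := hle h
    rwa [Ideal.mem_comap, AlgHom.commutes] at this
  · rintro ⟨l, rfl⟩
    exact Ideal.subset_span (Or.inl ⟨l, rfl⟩)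

/-- A `1`-form whose values on the vector fields `R(s)` vanish on the constraint surface takes values
vanishing on the constraint surface on all trivial vector fields. -/
theorem apply_mem_constraintIdeal {α : OneForm A} (hα : ∀ s, α (R s) ∈ constraintIdeal T)
    {W : VecField A} (hW : ExteriorAlgebra.ι A W ∈ trivialIdeal T R) :
    α W ∈ constraintIdeal T := by
  -- The map W ↦ ε α(W) into the dual numbers over A/𝔠 squares to zero, so it extends to an algebra
  -- map on multivectors. This map kills the generators of the trivial ideal, and on a vector field
  -- it reads off α modulo 𝔠.
  let B := A ⧸ (constraintIdeal T : Ideal A)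
  let φ : VecField A →ₗ[A] DualNumber B :=
    (TrivSqZeroExt.inrHom B B).restrictScalars A ∘ₗ
      (Ideal.Quotient.mkₐ A (constraintIdeal T)).toLinearMap ∘ₗ α
  have hφ : ∀ Y, φ Y * φ Y = 0 := fun Y => TrivSqZeroExt.inr_mul_inr B _ _
  let ψ : Multivector A →ₐ[A] DualNumber B := ExteriorAlgebra.lift A ⟨φ, hφ⟩
  have hψ : ∀ Y, ψ (ExteriorAlgebra.ι A Y) =
      TrivSqZeroExt.inr (Ideal.Quotient.mk (constraintIdeal T) (α Y)) := fun Y =>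
    ExteriorAlgebra.lift_ι_apply _ _ _ _
  have hle : trivialIdeal T R ≤ RingHom.ker ψ := by
    refine Ideal.span_le.mpr ?_
    rintro _ (⟨l, rfl⟩ | ⟨s, rfl⟩)
    · rw [SetLike.mem_coe, RingHom.mem_ker, AlgHom.commutes]
      have : algebraMap A B (l T) = 0 := Ideal.Quotient.eq_zero_iff_mem.mpr ⟨l, rfl⟩
      rw [IsScalarTower.algebraMap_apply A B (DualNumber B), this, map_zero]
    · rw [SetLike.mem_coe, RingHom.mem_ker, hψ, Ideal.Quotient.eq_zero_iff_mem.mpr (hα s),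
        TrivSqZeroExt.inr_zero]
  have h := hle hW
  rw [RingHom.mem_ker, hψ] at h
  exact Ideal.Quotient.eq_zero_iff_mem.mp (TrivSqZeroExt.inr_injective h)

theorem IsProjectibleVec.apply_mem {V : VecField A} (hV : IsProjectibleVec T R V) {f : A}
    (hf : f ∈ constraintIdeal T) : V f ∈ constraintIdeal T := by
  have h := hV _ (algebraMap_mem_trivialIdeal.mpr hf)
  rwa [schoutenVec_algebraMap, algebraMap_mem_trivialIdeal] at h

theorem IsProjectibleVec.lie_mem {V : VecField A} (hV : IsProjectibleVec T R V) (s : S) :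
    ExteriorAlgebra.ι A ⁅V, R s⁆ ∈ trivialIdeal T R := by
  have h := hV _ (Ideal.subset_span (Or.inr ⟨s, rfl⟩))
  rwa [schoutenVec_ι] at h

/-- Contraction with df is an antiderivation that sends the generators ⟨λ, T⟩ to 0 and R(s) to
R(s)f, hence into the ideal. -/
theorem contract_mul_mem_trivialIdeal {f : A} (hf : ∀ s, R s f ∈ constraintIdeal T)
    {U : Multivector A} (hU : U ∈ trivialIdeal T R) :
    ∀ W : Multivector A, contract (dFun f) (W * U) ∈ trivialIdeal T R := by
  have hgen : ∀ U ∈ trivialIdeal T R, contract (dFun f) U ∈ trivialIdeal T R →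
      ∀ W : Multivector A, contract (dFun f) (W * U) ∈ trivialIdeal T R := by
    intro U hU hc W
    induction W using CliffordAlgebra.left_induction with
    | algebraMap r =>
      change contract (dFun f) (algebraMap A (Multivector A) r * U) ∈ _
      rw [← Algebra.smul_def, map_smul, Algebra.smul_def]
      exact Ideal.mul_mem_left _ _ hc
    | add x y hx hy =>
      rw [add_mul, map_add]
      exact add_mem hx hy
    | ι_mul x v hx =>
      change contract (dFun f) (ExteriorAlgebra.ι A v * x * U) ∈ _
      rw [mul_assoc, contract_ι_mul, Algebra.smul_def]
      exact sub_mem (Ideal.mul_mem_left _ _ (Ideal.mul_mem_left _ _ hU))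
        (Ideal.mul_mem_left _ _ hx)
  -- Contraction is not linear over multivectors; quantifying over the left factor W lets it absorb
  -- the coefficients of the span.
  refine Submodule.span_induction (p := fun U _ => ∀ W : Multivector A,
    contract (dFun f) (W * U) ∈ trivialIdeal T R) ?_ ?_ ?_ ?_ hU
  · intro U hU
    refine hgen U (Ideal.subset_span hU) ?_
    obtain ⟨l, rfl⟩ | ⟨s, rfl⟩ := hU
    · rw [contract_algebraMap]
      exact zero_mem _
    · rw [contract_ι, algebraMap_mem_trivialIdeal]
      exact hf s
  · intro W
    rw [mul_zero, map_zero]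
    exact zero_mem _
  · intro x y _ _ hx hy W
    rw [mul_add, map_add]
    exact add_mem (hx W) (hy W)
  · intro a x _ hx W
    rw [smul_eq_mul, ← mul_assoc]
    exact hx _

/-- A function is projectible if it is constant along the `R(s)` on the constraint surface. -/
theorem isProjectibleFun_of_apply_mem {f : A} (hf : ∀ s, R s f ∈ constraintIdeal T) :
    IsProjectibleFun T R f := by
  intro U hU
  rw [schoutenFun, contractLeft_eq_contract]
  refine neg_mem ?_
  rw [← one_mul U]
  exact contract_mul_mem_trivialIdeal hf hU 1

end ConstraintIdeal

/-! ## Low-order terms on the supermanifold -/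

section LowOrder

variable {A : Type*} [CommRing A] [Algebra ℝ A] {P : Type*} [AddCommGroup P] [Module A P]
  {S : Type*} [AddCommGroup S] [Module A S] {T : P} {R : S →ₗ[A] VecField A}

theorem SVec.mem_gh {k l m : ℤ} (Y : SVec A P S k) {g : Super A P S} (hg : g ∈ gh A P S l)
    (h : l + k = m) : Y g ∈ gh A P S m := by
  subst h
  exact Y.degree' _ _ hg

/-- The restriction to `M` of the action of a vector field of ghost number `0`. -/
theorem ExtendsVec.body_apply {Z : SVec A P S 0} {Y : VecField A} (hZ : ExtendsVec Z Y) :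
    ∀ g ∈ gh A P S 0, body A P S (Z g) = Y (body A P S g) := by
  refine gh_induction ?_ (by simp) (fun u w hu hw => by simp only [map_add, hu, hw])
  intro p q x y h hx hy
  have hx' := mem_gh_of_eta_pow (S := S) hx
  have hy' := mem_gh_of_ghost_pow (P := P) hy
  by_cases hp : p = 0
  · obtain rfl : q = 0 := by omega
    subst hp
    rw [pow_zero, Submodule.mem_one] at hx hy
    obtain ⟨a, rfl⟩ := hx
    obtain ⟨b, rfl⟩ := hy
    rw [← map_mul, hZ, body_algebraMap]
  -- Here p = q > 0, and each Leibniz term keeps an undifferentiated factor that vanishes on M.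
  · have hq : q ≠ 0 := by omega
    rw [Z.leibniz' _ _ hx', map_add, map_zsmul, map_mul, map_mul, map_mul,
      body_eq_zero_of_eta_pow hp hx, body_eq_zero_of_ghost_pow hq hy]
    simp

namespace BRSTDifferential

variable (D : BRSTDifferential T R)

/-- A monomial of ghost number -1 has one more η than c. Its η-part vanishes on M, so Q must hit
that part; the remaining c-part survives only when it is a scalar, which leaves a single η. -/
theorem body_Q_mem : ∀ g ∈ gh A P S (-1), body A P S (D.Q g) ∈ constraintIdeal T := by
  refine gh_induction ?_ (by simp)
    (fun u w hu hw => by rw [map_add, map_add]; exact add_mem hu hw)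
  intro p q x y h hx hy
  have hx' := mem_gh_of_eta_pow (S := S) hx
  have hp : p = q + 1 := by omega
  subst hp
  have hbx := body_eq_zero_of_eta_pow (Nat.succ_ne_zero q) hx
  rw [D.Q.leibniz' _ _ hx', map_add, map_zsmul, map_mul, map_mul, hbx, zero_mul, smul_zero,
    add_zero]
  by_cases hq : q = 0
  · subst hq
    rw [zero_add, pow_one] at hx
    obtain ⟨l, rfl⟩ := hx
    exact Ideal.mul_mem_right _ _ ⟨l, (D.on_eta l).symm⟩
  · rw [body_eq_zero_of_ghost_pow hq hy, mul_zero]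
    exact zero_mem _

/-- `[Q, i_s]` extends the vector field `R(s)`. -/
theorem extends_bracket_ghostContract (s : S) :
    ExtendsVec (bracket D.Q (ghostContract P s) : SVec A P S (1 + -1)) (R s) := by
  intro f
  -- The term Q(i_s f) vanishes, and the sign for two odd fields turns the remaining difference into
  -- a sum.
  have h : (bracket D.Q (ghostContract P s)) (algebraMap A (Super A P S) f) =
      ghostContract P s (D.Q (algebraMap A (Super A P S) f)) := by
    change D.Q (ghostContract P s (algebraMap A (Super A P S) f)) -
      sgn (1 * -1) • ghostContract P s (D.Q (algebraMap A (Super A P S) f)) = _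
    rw [ghostContract_apply, contract_algebraMap, map_zero]
    simp [sgn]
  refine (congrArg (body A P S) h).trans ?_
  -- Contracting in c and then restricting to M sees only the part of Qf at η = 0, which is the
  -- prescribed term c^α R_α(f).
  rw [ghostContract_apply, body_contract, D.on_fun, contract_ι, AlgHom.commutes]
  rfl

/-- The value of a form on a vector field, when of ghost number `-1`, is mapped by `Q` to a function
vanishing on the constraint surface. -/
theorem body_Q_form_mem {l k : ℤ} (Y : SVec A P S k) (hk : l + k + 1 = -1) {θ : Cochain A P S}
    (hθ : θ ∈ SForm A P S l) : body A P S (D.Q (θ k Y)) ∈ constraintIdeal T := by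
  unfold SForm at hθ
  induction hθ using AddSubgroup.closure_induction with
  | mem x hx =>
    obtain ⟨i, j, g, hg, f, hf, hl, rfl⟩ := hx
    have hYg := Y.degree' _ _ hg
    rw [dMul, D.Q.leibniz' _ _ hYg, map_add, map_zsmul, map_mul, map_mul]
    refine add_mem ?_ (zsmul_mem ?_ _)
    -- On M only factors of ghost number 0 survive. If the factor that Q does not touch is of this
    -- kind, the other has ghost number -1 and `body_Q_mem` applies.
    · by_cases hj : j = 0
      · rw [show i + k = -1 by omega] at hYg
        exact Ideal.mul_mem_right _ _ (D.body_Q_mem _ hYg)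
      · rw [body_eq_zero_of_mem_gh hj _ hf, mul_zero]
        exact zero_mem _
    · by_cases hi : i + k = 0
      · rw [show j = -1 by omega] at hf
        exact Ideal.mul_mem_left _ _ (D.body_Q_mem f hf)
      · rw [body_eq_zero_of_mem_gh hi _ hYg, zero_mul]
        exact zero_mem _
  | zero => simp
  | add x y _ _ hx hy =>
    rw [Pi.add_apply, Pi.add_apply, map_add, map_add]
    exact add_mem hx hy
  | neg x _ hx =>
    rw [Pi.neg_apply, Pi.neg_apply, map_neg, map_neg]
    exact neg_mem hx

variable {D} in
theorem body_bracket_mem {X : VecField A} (hX : ∀ f ∈ constraintIdeal T, X f ∈ constraintIdeal T)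
    {X' : SVec A P S 0} (hX' : ExtendsVec X' X) {g : Super A P S} (hg : g ∈ gh A P S (-1)) :
    body A P S (bracket D.Q X' g) ∈ constraintIdeal T := by
  change body A P S (D.Q (X' g) - sgn (1 * 0) • X' (D.Q g)) ∈ _
  have hQ : D.Q g ∈ gh A P S 0 := D.Q.mem_gh hg (by norm_num)
  rw [map_sub, map_zsmul, hX'.body_apply _ hQ]
  refine sub_mem (D.body_Q_mem _ ?_) (zsmul_mem (hX _ (D.body_Q_mem _ hg)) _)
  exact X'.mem_gh hg (by norm_num)

/-- The value at `X` of the restriction to `M` of a `Q̂`-coboundary vanishes on the constraint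
surface, for `X` preserving the ideal of that surface. -/
theorem body_Qhat_mem {X : VecField A} (hX : ∀ f ∈ constraintIdeal T, X f ∈ constraintIdeal T)
    {X' : SVec A P S 0} (hX' : ExtendsVec X' X) {σ : Cochain A P S} (hσ : σ ∈ SForm A P S (-2)) :
    body A P S (D.Qhat σ 0 X') ∈ constraintIdeal T := by
  -- Q̂σ(X') is Q(σ(X')) minus σ([Q, X']), and the two terms lie in 𝔠 separately. In the second, [Q,
  -- X'] sends functions of ghost number -1 into 𝔠 on M, because both Q X' and X' Q do.
  have h : body A P S (σ (1 + 0) (bracket D.Q X')) ∈ constraintIdeal T := by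
    unfold SForm at hσ
    induction hσ using AddSubgroup.closure_induction with
    | mem x hx =>
      obtain ⟨i, j, g, hg, f, hf, hl, rfl⟩ := hx
      rw [dMul, map_mul]
      by_cases hj : j = 0
      · obtain rfl : i = -1 := by omega
        exact Ideal.mul_mem_right _ _ (body_bracket_mem hX hX' hg)
      · rw [body_eq_zero_of_mem_gh hj _ hf, mul_zero]
        exact zero_mem _
    | zero => simp
    | add x y _ _ hx hy =>
      rw [Pi.add_apply, Pi.add_apply, map_add]
      exact add_mem hx hy
    | neg x _ hx =>
      rw [Pi.neg_apply, Pi.neg_apply, map_neg]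
      exact neg_mem hx
  change body A P S (sgn (1 * 0) • (D.Q (σ 0 X') - σ (1 + 0) (bracket D.Q X'))) ∈ _
  rw [map_zsmul, map_sub]
  exact zsmul_mem (sub_mem (D.body_Q_form_mem X' (by norm_num) hσ) h) _

/-- A projectible `1`-form vanishes on the vector fields `R(s)` along the constraint surface. -/
theorem IsProjectibleForm.apply_R_mem {α : OneForm A} (hα : D.IsProjectibleForm α) (s : S) :
    α (R s) ∈ constraintIdeal T := by
  obtain ⟨θ, hθ, hext, hQ⟩ := hα
  -- Evaluated on i_s, the cocycle condition says Q(θ(i_s)) = θ([Q, i_s]). The left side is Q of a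
  -- function of ghost number -1; the right side restricts to α(R(s)).
  have h := congrFun (congrFun hQ (-1)) (ghostContract P s)
  change sgn (1 * -1) • (D.Q (θ (-1) (ghostContract P s)) -
    θ (1 + -1) (bracket D.Q (ghostContract P s))) = 0 at h
  have h' : D.Q (θ (-1) (ghostContract P s)) =
      θ (1 + -1) (bracket D.Q (ghostContract P s)) := by
    have := congrArg (fun x => sgn (1 * -1) • x) h
    simp only [smul_smul, sgn_sq, one_smul, smul_zero] at this
    exact sub_eq_zero.mp this
  have := hext _ _ (D.extends_bracket_ghostContract s)
  rw [← this]
  refine (congrArg (fun x => body A P S x ∈ constraintIdeal T) h').mp ?_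
  exact D.body_Q_form_mem _ (by norm_num) hθ

end BRSTDifferential

/-- Cartan calculus: the Lie derivative along a commutator. -/
theorem lieD_bracket {j k l : ℤ} (Y : SVec A P S j) (Z : SVec A P S k) {θ : Cochain A P S}
    (hθ : θ ∈ SForm A P S l) :
    lieD (bracket Y Z) θ = lieD Y (lieD Z θ) - sgn (j * k) • lieD Z (lieD Y θ) := by
  unfold SForm at hθ
  induction hθ using AddSubgroup.closure_induction with
  | mem x hx =>
    obtain ⟨i, m, g, hg, f, hf, hl, rfl⟩ := hx
    have hb : ∀ x, bracket Y Z x = Y (Z x) - sgn (j * k) • Z (Y x) := fun _ => rfl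
    rw [lieD_dMul _ hg, lieD_dMul _ hg, lieD_dMul _ hg, map_add, map_add, map_zsmul, map_zsmul,
      lieD_dMul _ (Z.degree' _ _ hg), lieD_dMul _ hg, lieD_dMul _ (Y.degree' _ _ hg),
      lieD_dMul _ hg, hb, hb]
    funext n W
    have hs := sgn_sq (j * k)
    simp only [dMul, Pi.add_apply, Pi.sub_apply, Pi.smul_apply, map_sub, map_zsmul, mul_add,
      add_mul, sgn_add, mul_comm k j, sub_mul, mul_sub, smul_mul_assoc, mul_smul_comm, smul_add,
      smul_sub, smul_smul]
    -- This sign identity cancels the cross terms d(Yg) · Zf coming from the two orders of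
    -- differentiation.
    have a1 : sgn (j * k) * (sgn (k * i) * sgn (j * k)) = sgn (k * i) := by
      rw [mul_left_comm, hs, mul_one]
    rw [a1]
    module
  | zero => simp
  | add x y _ _ hx hy =>
    simp only [map_add, hx, hy, smul_add]
    abel
  | neg x _ hx =>
    simp only [map_neg, hx, smul_neg]
    abel

/-- Leibniz rule for the action of a vector field of ghost number `0` on the values of a `1`-form,
restricted to `M`. -/
theorem ExtendsForm.apply_eq {α : OneForm A} {θ : Cochain A P S} (hθ : ExtendsForm θ α)
    (hmem : θ ∈ SForm A P S (-1)) {Z X' : SVec A P S 0} {Y X : VecField A} (hZ : ExtendsVec Z Y)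
    (hX' : ExtendsVec X' X) : Y (α X) = body A P S (lieD Z θ 0 X') + α ⁅Y, X⁆ := by
  have hb : ExtendsVec (bracket Z X' : SVec A P S (0 + 0)) ⁅Y, X⁆ := by
    intro f
    have hf := algebraMap_mem_gh (P := P) (S := S) f
    have hXf : X' (algebraMap A (Super A P S) f) ∈ gh A P S 0 := X'.mem_gh hf (by norm_num)
    have hZf : Z (algebraMap A (Super A P S) f) ∈ gh A P S 0 := Z.mem_gh hf (by norm_num)
    have e : bracket Z X' (algebraMap A (Super A P S) f) = Z (X' (algebraMap A (Super A P S) f)) -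
      sgn (0 * 0) • X' (Z (algebraMap A (Super A P S) f)) := rfl
    refine (congrArg (body A P S) e).trans ?_
    rw [map_sub, map_zsmul, hZ.body_apply _ hXf, hX'.body_apply _ hZf, hX', hZ,
      Derivation.commutator_apply]
    simp [sgn]
  -- The value θ(X') has ghost number 0. For dg · f with g of nonzero ghost number, both sides
  -- vanish on M; otherwise this is the ordinary Leibniz rule.
  have hv : body A P S (Z (θ 0 X')) = Y (body A P S (θ 0 X')) := by
    clear hθ
    unfold SForm at hmem
    induction hmem using AddSubgroup.closure_induction with
    | mem x hx =>
      obtain ⟨i, j, g, hg, f, hf, hl, rfl⟩ := hx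
      have hXg : X' g ∈ gh A P S i := X'.mem_gh hg (by simp)
      have hZXg : Z (X' g) ∈ gh A P S i := Z.mem_gh hXg (by simp)
      have hZf : Z f ∈ gh A P S j := Z.mem_gh hf (by simp)
      rw [dMul, Z.leibniz' _ _ hXg, map_add, map_zsmul, map_mul, map_mul, map_mul]
      by_cases hi : i = 0
      · obtain rfl : j = 0 := by omega
        subst hi
        rw [hZ.body_apply _ hXg, hZ.body_apply _ hf, Derivation.leibniz]
        simp [sgn]
        ring
      · simp [body_eq_zero_of_mem_gh hi _ hXg, body_eq_zero_of_mem_gh hi _ hZXg]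
    | zero => simp
    | add x y _ _ hx hy => simp only [Pi.add_apply, map_add, hx, hy]
    | neg x _ hx => simp only [Pi.neg_apply, map_neg, hx]
  have e : lieD Z θ 0 X' = Z (θ 0 X') - θ (0 + 0) (bracket Z X') := by
    change sgn (0 * 0) • (Z (θ 0 X') - θ (0 + 0) (bracket Z X')) = _
    simp [sgn]
  have e' : body A P S (θ (0 + 0) (bracket Z X')) = α ⁅Y, X⁆ := hθ (bracket Z X') _ hb
  have e'' : body A P S (θ 0 X') = α X := hθ X' X hX'
  rw [e, map_sub, e', hv, e'', sub_add_cancel]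

/-! ### Derivatives of α X along R(s) and V, and the cocycle property -/

namespace BRSTDifferential

variable {D : BRSTDifferential T R}

/-- Since [Q, i_s] lifts R(s) and Q̂θ = 0, the Lie derivative of θ along it is Q̂ of L_{i_s} θ. Its
value on the lift of X is in 𝔠, and the correction α([R(s), X]) is too because X is projectible. -/
theorem IsProjectibleForm.R_apply_mem (c : LinearConnection A P) (c' : LinearConnection A S)
    {α : OneForm A} (hα : D.IsProjectibleForm α) {X : VecField A} (hX : IsProjectibleVec T R X)
    (s : S) : R s (α X) ∈ constraintIdeal T := by
  have hαR := hα.apply_R_mem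
  obtain ⟨θ, hθ, hext, hQ⟩ := hα
  have hlift := horizontalLift_extends c c' X
  have hZ := D.extends_bracket_ghostContract s
  have h := hext.apply_eq hθ hZ hlift
  rw [h]
  refine add_mem ?_ ?_
  · have e := lieD_bracket D.Q (ghostContract P s) hθ
    have hQ' : lieD D.Q θ = 0 := hQ
    rw [hQ', map_zero, smul_zero, sub_zero] at e
    have e' := congrArg (body A P S) (congrFun (congrFun e 0) (horizontalLift c c' X))
    refine (congrArg (· ∈ constraintIdeal T) e').mpr ?_
    have hσ : lieD (ghostContract P s) θ ∈ SForm A P S (-2) := by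
      have := lieD_mem (ghostContract P s) hθ
      rwa [show (-1 : ℤ) + -1 = -2 by norm_num] at this
    exact D.body_Qhat_mem (fun f hf => hX.apply_mem hf) hlift hσ
  · rw [← lie_skew, map_neg]
    exact neg_mem (apply_mem_constraintIdeal hαR (hX.lie_mem s))

/-- The argument for R(s) applies with V' in place of [Q, i_s]: exactness of L_{V'} θ is now given,
and so is triviality of [V, X]. -/
theorem LieDerivativeVanishes.apply_mem (c : LinearConnection A P) (c' : LinearConnection A S)
    {α : OneForm A} {V X : VecField A} (hVα : D.LieDerivativeVanishes V α)
    (hX : IsProjectibleVec T R X)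
    (hVX : schoutenVec V (ExteriorAlgebra.ι _ X) ∈ trivialIdeal T R) :
    V (α X) ∈ constraintIdeal T := by
  obtain ⟨V', θ, ⟨hV', -⟩, hθ, τ, hτ, e⟩ := hVα
  have hlift := horizontalLift_extends c c' X
  rw [hθ.2.1.apply_eq hθ.1 hV' hlift, e]
  refine add_mem (D.body_Qhat_mem (fun f hf => hX.apply_mem hf) hlift hτ) ?_
  rw [schoutenVec_ι] at hVX
  exact apply_mem_constraintIdeal (IsProjectibleForm.apply_R_mem (D := D) ⟨θ, hθ⟩) hVX

theorem Q_apply_eq_zero {l k : ℤ} {θ : Cochain A P S} (hθ : θ ∈ SForm A P S l)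
    (hQ : D.Qhat θ = 0) {X' : SVec A P S k} (hX' : ∀ g, bracket D.Q X' g = 0) :
    D.Q (θ k X') = 0 := by
  -- A sum of forms dg · f depends on a vector field only through its action, so it vanishes on a
  -- field acting by zero.
  have h0 : θ (1 + k) (bracket D.Q X') = 0 := by
    clear hQ
    unfold SForm at hθ
    induction hθ using AddSubgroup.closure_induction with
    | mem x hx =>
      obtain ⟨i, j, g, hg, f, hf, hl, rfl⟩ := hx
      rw [dMul, hX', zero_mul]
    | zero => rfl
    | add x y _ _ hx hy => rw [Pi.add_apply, Pi.add_apply, hx, hy, add_zero]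
    | neg x _ hx => rw [Pi.neg_apply, Pi.neg_apply, hx, neg_zero]
  have h := congrFun (congrFun hQ k) X'
  change sgn (1 * k) • (D.Q (θ k X') - θ (1 + k) (bracket D.Q X')) = 0 at h
  rw [h0, sub_zero] at h
  have := congrArg (fun x => sgn (1 * k) • x) h
  simpa only [smul_smul, sgn_sq, one_smul, smul_zero] using this

end BRSTDifferential

end LowOrder

/-! ## Local frames and integral curves -/

section Frames

open Bundle

variable {EM : Type*} [NormedAddCommGroup EM] [NormedSpace ℝ EM]
  {M : Type*} [TopologicalSpace M] [ChartedSpace EM M]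
  {FE : Type*} [NormedAddCommGroup FE] [NormedSpace ℝ FE]
  {E : M → Type*} [TopologicalSpace (Bundle.TotalSpace FE E)] [∀ x, TopologicalSpace (E x)]
  [FiberBundle FE E] [∀ x, AddCommGroup (E x)] [∀ x, Module ℝ (E x)] [VectorBundle ℝ FE E]

theorem section_sum_apply {ι : Type*} (A : Finset ι) (s : ι → Cₛ^∞⟮𝓘(ℝ, EM); FE, E⟯) (x : M) :
    (∑ i ∈ A, s i) x = ∑ i ∈ A, s i x :=
  (congrFun (map_sum (ContMDiffSection.coeAddHom 𝓘(ℝ, EM) FE ∞ E) s A) x).trans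
    (Finset.sum_apply x A _)

theorem function_sum_apply {ι : Type*} (A : Finset ι) (f : ι → C^∞⟮𝓘(ℝ, EM), M; ℝ⟯) (x : M) :
    (∑ i ∈ A, f i) x = ∑ i ∈ A, f i x :=
  map_sum (ContMDiffMap.evalRingHom x) f A

/-- Near every point, up to a bump function `χ`, sections are combinations of finitely many global
sections whose coefficients are the values of functionals local on the base. -/
theorem exists_local_dual_frame [FiniteDimensional ℝ EM] [T2Space M] [IsManifold 𝓘(ℝ, EM) ∞ M]
    [FiniteDimensional ℝ FE] [ContMDiffVectorBundle ∞ FE E 𝓘(ℝ, EM)] (p : M) :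
    ∃ (n : ℕ) (χ : C^∞⟮𝓘(ℝ, EM), M; ℝ⟯) (ε : Fin n → Cₛ^∞⟮𝓘(ℝ, EM); FE, E⟯)
      (l : Fin n → Module.Dual C^∞⟮𝓘(ℝ, EM), M; ℝ⟯ Cₛ^∞⟮𝓘(ℝ, EM); FE, E⟯),
      χ p ≠ 0 ∧ (∀ s, χ • s = ∑ a, l a s • ε a) ∧ ∀ a s q, s q = 0 → l a s q = 0 := by
  have : ContMDiffVectorBundle 1 FE E 𝓘(ℝ, EM) := ContMDiffVectorBundle.of_le (n := ∞) (by simp)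
  let e := trivializationAt FE E p
  let b := Module.finBasis ℝ FE
  have hp : p ∈ e.baseSet := FiberBundle.mem_baseSet_trivializationAt' p
  obtain ⟨ρ, -, hρ⟩ := (SmoothBumpFunction.nhds_basis_tsupport (I := 𝓘(ℝ, EM)) p).mem_iff.mp
    (e.open_baseSet.mem_nhds hp)
  let χ₀ : C^∞⟮𝓘(ℝ, EM), M; ℝ⟯ := ⟨ρ, ρ.contMDiff⟩
  let ε : Fin (Module.finrank ℝ FE) → Cₛ^∞⟮𝓘(ℝ, EM); FE, E⟯ := fun a =>
    ⟨fun x => ρ x • e.localFrame b a x,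
      ContMDiffOn.smul_section_of_tsupport ρ.contMDiff.contMDiffOn e.open_baseSet hρ
        (e.contMDiffOn_localFrame_baseSet ∞ b a)⟩
  let c : Fin (Module.finrank ℝ FE) → Cₛ^∞⟮𝓘(ℝ, EM); FE, E⟯ → C^∞⟮𝓘(ℝ, EM), M; ℝ⟯ := fun a s =>
    ⟨fun x => ρ x * e.localFrameCoeff 𝓘(ℝ, EM) b a x (s x), by
      refine contMDiff_of_tsupport fun x hx => ?_
      have hx' : x ∈ e.baseSet := hρ (tsupport_mul_subset_left hx)
      exact ρ.contMDiffAt.mul (contMDiffAt_localFrameCoeff b hx' s.contMDiff.contMDiffAt a)⟩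
  let l : Fin (Module.finrank ℝ FE) →
      Module.Dual C^∞⟮𝓘(ℝ, EM), M; ℝ⟯ Cₛ^∞⟮𝓘(ℝ, EM); FE, E⟯ := fun a =>
    { toFun := c a
      map_add' s t := by
        ext x
        change ρ x * _ = ρ x * _ + ρ x * _
        rw [ContMDiffSection.coe_add, Pi.add_apply, map_add, mul_add]
      map_smul' f s := by
        ext x
        change ρ x * _ = f x * (ρ x * _)
        rw [section_smul_apply, map_smul, smul_eq_mul, mul_left_comm] }
  -- One factor ρ extends the frame to global sections, the other extends the coefficients to global
  -- functions; hence χ = ρ².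
  refine ⟨_, χ₀ * χ₀, ε, l, ?_, fun s => ?_, fun a s q hs => ?_⟩
  · change ρ p * ρ p ≠ 0
    rw [ρ.eq_one]
    norm_num
  · ext x
    rw [section_smul_apply, section_sum_apply]
    change (ρ x * ρ x) • s x = ∑ a, (ρ x * _) • ρ x • e.localFrame b a x
    by_cases hx : x ∈ e.baseSet
    · conv_lhs => rw [e.eq_sum_localFrameCoeff_smul (I := 𝓘(ℝ, EM)) (b := b) (s := s) hx]
      rw [Finset.smul_sum]
      refine Finset.sum_congr rfl fun a _ => ?_
      rw [smul_smul, smul_smul]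
      congr 1
      ring
    · have : ρ x = 0 := image_eq_zero_of_notMem_tsupport fun h => hx (hρ h)
      simp [this]
  · change ρ q * _ = 0
    rw [hs, map_zero, mul_zero]

variable [FiniteDimensional ℝ EM] [T2Space M] [IsManifold 𝓘(ℝ, EM) ∞ M]
  [FiniteDimensional ℝ FE] [ContMDiffVectorBundle ∞ FE E 𝓘(ℝ, EM)]
  {T : Cₛ^∞⟮𝓘(ℝ, EM); FE, E⟯}

/-- A functional m on sections is only assumed function-linear, so its locality needs proof:
expanding T in the frame gives χ m(T) = Σ l_a(T) m(ε_a), and each l_a(T) vanishes at p. -/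
theorem eq_zero_of_mem_constraintIdeal {f : C^∞⟮𝓘(ℝ, EM), M; ℝ⟯} (hf : f ∈ constraintIdeal T)
    {p : M} (hp : T p = 0) : f p = 0 := by
  obtain ⟨m, rfl⟩ := hf
  obtain ⟨n, χ, ε, l, hχ, hl, hloc⟩ := exists_local_dual_frame (EM := EM) (FE := FE) (E := E) p
  have h : χ p * m T p = 0 := by
    have e := congrArg (fun f : C^∞⟮𝓘(ℝ, EM), M; ℝ⟯ => f p) (congrArg m (hl T))
    simp only [map_smul, map_sum, function_sum_apply] at e
    refine e.trans (Finset.sum_eq_zero fun a _ => ?_)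
    change l a T p * _ = 0
    rw [hloc a T p hp, zero_mul]
  exact (mul_eq_zero.mp h).resolve_left hχ

theorem eq_zero_iff_constraintIdeal {p : M} : T p = 0 ↔
    ∀ f : C^∞⟮𝓘(ℝ, EM), M; ℝ⟯, f ∈ constraintIdeal T → f p = 0 := by
  refine ⟨fun hp f hf => eq_zero_of_mem_constraintIdeal hf hp, fun h => ?_⟩
  obtain ⟨n, χ, ε, l, hχ, hl, -⟩ := exists_local_dual_frame (EM := EM) (FE := FE) (E := E) p
  have e := congrArg (fun s : Cₛ^∞⟮𝓘(ℝ, EM); FE, E⟯ => s p) (hl T)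
  simp only [section_smul_apply, section_sum_apply] at e
  rw [Finset.sum_eq_zero fun a _ => by
    rw [show l a T p = 0 from h _ ⟨l a, rfl⟩, zero_smul]] at e
  exact (smul_eq_zero.mp e).resolve_left hχ

end Frames

/-- Uniqueness for a linear homogeneous system of differential equations with coefficients
continuous at the initial time. -/
theorem linear_ode_eventually_eq_zero {n : ℕ} {u : ℝ → Fin n → ℝ} {k : Fin n → Fin n → ℝ → ℝ}
    {t₀ : ℝ} (hk : ∀ a b, ContinuousAt (k a b) t₀)
    (hu : ∀ᶠ t in nhds t₀, ∀ a, HasDerivAt (fun t => u t a) (∑ b, k a b t * u t b) t)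
    (h0 : u t₀ = 0) : ∀ᶠ t in nhds t₀, u t = 0 := by
  -- A Lipschitz constant in the sup norm for all t near t₀; continuity at t₀ alone bounds each
  -- coefficient up to the added 1.
  let C : ℝ := ∑ a, ∑ b, (|k a b t₀| + 1)
  have hC : 0 ≤ C := by positivity
  have hbound : ∀ᶠ t in nhds t₀, ∀ a b, |k a b t| ≤ |k a b t₀| + 1 := by
    rw [Filter.eventually_all]
    intro a
    rw [Filter.eventually_all]
    intro b
    exact ((hk a b).abs.eventually_lt continuousAt_const (lt_add_one _)).mono fun _ h => h.le
  refine ODE_solution_unique_of_eventually (v := fun t x a => ∑ b, k a b t * x b)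
    (s := fun _ => Set.univ) (K := C.toNNReal) ?_ ?_ ?_ h0
  · filter_upwards [hbound] with t ht
    refine (LipschitzWith.of_dist_le_mul fun x y => ?_).lipschitzOnWith
    rw [Real.coe_toNNReal _ hC, dist_pi_le_iff (by positivity)]
    intro a
    rw [Real.dist_eq, ← Finset.sum_sub_distrib]
    have h1 : (∑ b, (|k a b t₀| + 1)) ≤ C :=
      Finset.single_le_sum (f := fun a => ∑ b, (|k a b t₀| + 1)) (fun _ _ => by positivity)
        (Finset.mem_univ a)
    refine le_trans ?_ (mul_le_mul_of_nonneg_right h1 dist_nonneg)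
    rw [Finset.sum_mul]
    refine (Finset.abs_sum_le_sum_abs _ _).trans (Finset.sum_le_sum fun b _ => ?_)
    rw [← mul_sub, abs_mul]
    exact mul_le_mul (ht a b) (dist_le_pi_dist x y b) (abs_nonneg _) (by positivity)
  · filter_upwards [hu] with t ht
    exact ⟨hasDerivAt_pi.mpr ht, trivial⟩
  · refine Filter.Eventually.of_forall fun t => ⟨?_, trivial⟩
    have : (fun a => ∑ b, k a b t * (0 : Fin n → ℝ) b) = 0 := by
      ext a
      simp
    rw [this]
    exact hasDerivAt_const t 0

/-! ### Integral curves and the constraint surface -/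

section Curves

variable {EM : Type*} [NormedAddCommGroup EM] [NormedSpace ℝ EM] [FiniteDimensional ℝ EM]
  {M : Type*} [TopologicalSpace M] [T2Space M] [ChartedSpace EM M] [IsManifold 𝓘(ℝ, EM) ∞ M]
  {FE : Type*} [NormedAddCommGroup FE] [NormedSpace ℝ FE] [FiniteDimensional ℝ FE]
  {E : M → Type*} [TopologicalSpace (Bundle.TotalSpace FE E)] [∀ x, TopologicalSpace (E x)]
  [FiberBundle FE E] [∀ x, AddCommGroup (E x)] [∀ x, Module ℝ (E x)] [VectorBundle ℝ FE E]
  [ContMDiffVectorBundle ∞ FE E 𝓘(ℝ, EM)]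
  {T : Cₛ^∞⟮𝓘(ℝ, EM); FE, E⟯} {V : VecField C^∞⟮𝓘(ℝ, EM), M; ℝ⟯} {γ : ℝ → M} {I : Set ℝ}

/-- Since V preserves 𝔠, V(l_a T) = m_a(T) for some functional m_a. Expanding T in the frame, the
functions l_a(T) along γ satisfy a linear homogeneous system with coefficients m_a(ε_b)/χ, and they
vanish at t₀. -/
theorem IsIntegralCurve.eventually_eq_zero (hV : ∀ f ∈ constraintIdeal T, V f ∈ constraintIdeal T)
    (hI : IsOpen I) (hγ : IsIntegralCurve V γ I) {t₀ : ℝ} (ht₀ : t₀ ∈ I) (h0 : T (γ t₀) = 0) :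
    ∀ᶠ t in nhds t₀, T (γ t) = 0 := by
  obtain ⟨n, χ, ε, l, hχ, hl, hloc⟩ := exists_local_dual_frame (EM := EM) (FE := FE) (E := E) (γ t₀)
  have hm : ∀ a, ∃ m : Module.Dual C^∞⟮𝓘(ℝ, EM), M; ℝ⟯ Cₛ^∞⟮𝓘(ℝ, EM); FE, E⟯,
      m T = V (l a T) := fun a => hV _ ⟨l a, rfl⟩
  choose m hm using hm
  have hsmul : ∀ a x, χ x * V (l a T) x = ∑ b, l b T x * m a (ε b) x := by
    intro a x
    have e := congrArg (fun f : C^∞⟮𝓘(ℝ, EM), M; ℝ⟯ => f x) (congrArg (m a) (hl T))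
    simp only [map_smul, map_sum, function_sum_apply, hm] at e
    exact e
  have hcont : ∀ f : C^∞⟮𝓘(ℝ, EM), M; ℝ⟯, ContinuousAt (fun t => f (γ t)) t₀ :=
    fun f => (hγ t₀ ht₀ f).continuousAt
  have hne : ∀ᶠ t in nhds t₀, χ (γ t) ≠ 0 := (hcont χ).eventually_ne hχ
  have hu := linear_ode_eventually_eq_zero (u := fun t a => l a T (γ t))
    (k := fun a b t => m a (ε b) (γ t) / χ (γ t)) (t₀ := t₀)
    (fun a b => (hcont _).div (hcont χ) hχ) ?_ (funext fun a => hloc a T _ h0)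
  · filter_upwards [hu, hne] with t ht hχt
    have e := congrArg (fun s : Cₛ^∞⟮𝓘(ℝ, EM); FE, E⟯ => s (γ t)) (hl T)
    simp only [section_smul_apply, section_sum_apply] at e
    rw [Finset.sum_eq_zero fun a _ => by
      rw [show l a T (γ t) = 0 from congrFun ht a, zero_smul]] at e
    exact (smul_eq_zero.mp e).resolve_left hχt
  · filter_upwards [hne, hI.mem_nhds ht₀] with t hχt htI a
    have h := hγ t htI (l a T)
    have e : V (l a T) (γ t) = ∑ b, m a (ε b) (γ t) / χ (γ t) * l b T (γ t) := by
      rw [← mul_right_inj' hχt, hsmul, Finset.mul_sum]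
      refine Finset.sum_congr rfl fun b _ => ?_
      field_simp
    rwa [e] at h

/-- An integral curve of a vector field that preserves the ideal of the constraint surface stays in
that surface if it meets it. -/
theorem IsIntegralCurve.eq_zero (hV : ∀ f ∈ constraintIdeal T, V f ∈ constraintIdeal T)
    (hI : IsOpen I) (hI' : IsPreconnected I) (hγ : IsIntegralCurve V γ I) {t₀ : ℝ} (ht₀ : t₀ ∈ I)
    (h0 : T (γ t₀) = 0) : ∀ t ∈ I, T (γ t) = 0 := by
  let Z : Set ℝ := {t | t ∈ I ∧ T (γ t) = 0}
  have hZ : IsOpen Z := by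
    rw [isOpen_iff_mem_nhds]
    rintro t ⟨ht, h⟩
    filter_upwards [hI.mem_nhds ht, hγ.eventually_eq_zero hV hI ht h] with r h1 h2
    exact ⟨h1, h2⟩
  have hsub : I ⊆ Z := by
    refine hI'.subset_of_closure_inter_subset hZ ⟨t₀, ht₀, ht₀, h0⟩ ?_
    rintro t ⟨hcl, ht⟩
    -- Closedness is tested on the functions f ∈ 𝔠, whose composites with γ are continuous because
    -- they are differentiable; continuity of γ itself is not assumed.
    refine ⟨ht, eq_zero_iff_constraintIdeal.mpr fun f hf => ?_⟩
    have hc : ContinuousAt (fun t => f (γ t)) t := (hγ t ht f).continuousAt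
    have : f (γ t) ∈ closure ((fun t => f (γ t)) '' Z) :=
      mem_closure_image hc hcl
    have hle : (fun t => f (γ t)) '' Z ⊆ {0} := by
      rintro _ ⟨r, hr, rfl⟩
      exact eq_zero_of_mem_constraintIdeal hf hr.2
    simpa using closure_mono hle this
  exact fun t ht => (hsub ht).2

theorem IsIntegralCurve.apply_eq {f : C^∞⟮𝓘(ℝ, EM), M; ℝ⟯} (hf : V f ∈ constraintIdeal T)
    (hI : IsOpen I) (hI' : IsPreconnected I) (hγ : IsIntegralCurve V γ I)
    (h0 : ∀ t ∈ I, T (γ t) = 0) {t t₀ : ℝ} (ht : t ∈ I) (ht₀ : t₀ ∈ I) :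
    f (γ t) = f (γ t₀) := by
  refine hI.is_const_of_deriv_eq_zero (f := fun t => f (γ t)) hI'
    (fun r hr => (hγ r hr f).differentiableAt.differentiableWithinAt) (fun r hr => ?_) ht ht₀
  rw [(hγ r hr f).deriv]
  exact eq_zero_of_mem_constraintIdeal hf (h0 r hr)

end Curves

end GaugeBRST

end

theorem mainTheorem6
    {EM : Type*} [NormedAddCommGroup EM] [NormedSpace ℝ EM] [FiniteDimensional ℝ EM]
    {M : Type*} [TopologicalSpace M] [T2Space M] [SigmaCompactSpace M]
    [ChartedSpace EM M] [IsManifold 𝓘(ℝ, EM) ∞ M]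
    {FE : Type*} [NormedAddCommGroup FE] [NormedSpace ℝ FE] [FiniteDimensional ℝ FE]
    {E : M → Type*} [TopologicalSpace (Bundle.TotalSpace FE E)] [∀ x, TopologicalSpace (E x)]
    [FiberBundle FE E] [∀ x, AddCommGroup (E x)] [∀ x, Module ℝ (E x)] [VectorBundle ℝ FE E]
    [ContMDiffVectorBundle ∞ FE E 𝓘(ℝ, EM)]
    {FF : Type*} [NormedAddCommGroup FF] [NormedSpace ℝ FF] [FiniteDimensional ℝ FF]
    {F : M → Type*} [TopologicalSpace (Bundle.TotalSpace FF F)] [∀ x, TopologicalSpace (F x)]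
    [FiberBundle FF F] [∀ x, AddCommGroup (F x)] [∀ x, Module ℝ (F x)] [VectorBundle ℝ FF F]
    [ContMDiffVectorBundle ∞ FF F 𝓘(ℝ, EM)]
    (G : GaugeBRST.GaugeSystem EM M FE E FF F)
    (D : GaugeBRST.BRSTDifferential G.T G.R)
    (V X : GaugeBRST.VecField C^∞⟮𝓘(ℝ, EM), M; ℝ⟯)
    (α : GaugeBRST.OneForm C^∞⟮𝓘(ℝ, EM), M; ℝ⟯)
    (hV : GaugeBRST.IsProjectibleVec G.T G.R V)
    (hX : GaugeBRST.IsProjectibleVec G.T G.R X)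
    (hα : D.IsProjectibleForm α)
    (hVα : D.LieDerivativeVanishes V α)
    (hVX : GaugeBRST.schoutenVec V (ExteriorAlgebra.ι _ X) ∈ GaugeBRST.trivialIdeal G.T G.R) :
    -- the function `α X` is projectible
    GaugeBRST.IsProjectibleFun G.T G.R (α X) ∧
    -- its evolution along `V` is trivial
    GaugeBRST.schoutenVec V (algebraMap _ _ (α X)) ∈ GaugeBRST.trivialIdeal G.T G.R ∧
    -- contractions of cocycle extensions of `α` and `X` are cocycle extensions of `α X`
    (∀ X' θ, D.IsCocycleExtVec X' X → D.IsCocycleExtForm θ α →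
      GaugeBRST.body _ _ _ (θ 0 X') = α X ∧ D.Q (θ 0 X') = 0) ∧
    -- an integral curve of `V` that meets the constraint surface stays in it, and `α X` is constant
    -- along the curve
    (∀ (γ : ℝ → M) (s : Set ℝ), IsOpen s → IsPreconnected s → GaugeBRST.IsIntegralCurve V γ s →
      ∀ t₀ ∈ s, G.T (γ t₀) = 0 → ∀ t ∈ s, G.T (γ t) = 0 ∧ α X (γ t) = α X (γ t₀)) := by
  -- The connections enter through the horizontal lift of X.
  have hF := hα.R_apply_mem G.connE G.connF hX
  have hVF := hVα.apply_mem G.connE G.connF hX hVX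
  refine ⟨GaugeBRST.isProjectibleFun_of_apply_mem hF, ?_, ?_, ?_⟩
  · rw [GaugeBRST.schoutenVec_algebraMap]
    exact GaugeBRST.algebraMap_mem_trivialIdeal.mpr hVF
  · intro X' θ hX' hθ
    exact ⟨hθ.2.1 X' X hX'.1, D.Q_apply_eq_zero hθ.1 hθ.2.2 hX'.2⟩
  · intro γ s hs hs' hγ t₀ ht₀ h0 t ht
    have hz := hγ.eq_zero (fun f hf => hV.apply_mem hf) hs hs' ht₀ h0
    exact ⟨hz t ht, hγ.apply_eq hVF hs hs' hz ht ht₀⟩
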